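/- **Setting.** Let $G=(V,E)$ be an undirected graph with $n\ge 3$ vertices and positive real edge weights $w$; $|P|$ is the length of a path $P$, and $\delta_F(a,b)$ is the distance of $a,b$ in a subgraph $F$ ($+\infty$ if they are not connected). For $A\subseteq V$ and $a,b\in V\setminus A$ let $\pi_{G-A}(a,b)$ be a shortest $a$–$b$ path in $G-A$, fixed once for all $A,a,b$ (any choice is allowed). Let $d\ge 2$ be an integer, $c\ge 1$, $\epsilon>0$, $k=\ln n$, $s=4e\,d^{c+1}\ln^2 n+1$, $\epsilon_1=\epsilon/(2+\epsilon)$, $\epsilon_2=\epsilon_1/(2k-1)$. *Tree covers.* An $S$-restricted tree cover of a graph $F$ consists of one subtree $T(r)$ of $F$ rooted at $r$ for every $r\in S$, such that (i) for all $u\in S$ and $v\in V(F)$ connected to $u$ in $F$, some $T(r)$ contains both and the weighted depths satisfy $\mathrm{dep}_{T(r)}(u)+\mathrm{dep}_{T(r)}(v)\le(2k-1)\,\delta_F(u,v)$; (ii) every vertex is in at most $kn^{1/k}(\ln n+1)$ of the trees. For all $R,S\subseteq V$ let $\mathcal T_R(S)$ be any fixed $(S\setminus R)$-restricted tree cover of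 $G-R$, and $\mathcal T(S)=\mathcal T_\varnothing(S)$. For a tree $T$ of an $S$-restricted cover, $\mathrm{Trunk}(T)$ is the set of vertices on tree paths between two vertices of $S$; the pseudo-degree of a vertex $v$ in $T$ is its degree in the subtree induced by $\mathrm{Trunk}(T)$, and $0$ if $v\notin\mathrm{Trunk}(T)$. $\mathrm{Hi}$ of a cover is the set of vertices whose pseudo-degree exceeds $s$ in some tree of it. *Hierarchy tree.* Its root is $V$. A node $U$ is a leaf if $\mathrm{Hi}(\mathcal T(U))=\varnothing$; otherwise its children are $W_1,\dots,W_d$, where $W_0=\varnothing$ and $W_{i+1}=W_i\cup\mathrm{Hi}(\mathcal T_{W_i}(U))$. *Query.* Let $D\subseteq V$ with $|D|\le d$ and $u_0,v_0\in V\setminus D$. Start with $U_1=V$ and repeat, for at most $\lfloor\frac1c\log_d n\rfloor$ rounds: if $U_i$ is a leaf, stop; otherwise let $j\in[0,d]$ be least with $D\cap(W_{j+1}\setminus W_j)=\varnothing$ (with $W_{d+1}=W_d$ for the children of $U_i$); if $j=0$, stop; else $U_{i+1}=W_j$. Let $U_1,\dots,U_p$ be the resulting sequence, $U_{p+1}=\varnothing$,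 and let the level $l(x)$ be the largest $i$ with $x\in U_i$. *Decision trees.* Two inner vertices $a,b$ of a path $P$ from $x$ to $y$ are in the same segment if $|P[x,a]|,|P[x,b]|\le|P|/2$ and $\lfloor\log_{1+\epsilon_2}|P[x,a]|\rfloor=\lfloor\log_{1+\epsilon_2}|P[x,b]|\rfloor$, or $|P[a,y]|,|P[b,y]|<|P|/2$ and $\lfloor\log_{1+\epsilon_2}|P[a,y]|\rfloor=\lfloor\log_{1+\epsilon_2}|P[b,y]|\rfloor$; $\mathrm{seg}(a,P)$ is the segment of $a$. The decision tree $FT(x,y)$ has depth $d$. Each node $\alpha$ carries a set $\mathrm{avoid}(\alpha)$, empty at the root, and the path $P_\alpha=\pi_{G-\mathrm{avoid}(\alpha)}(x,y)$ (no vertices and length $+\infty$ if there is none). A node $\alpha$ of depth less than $d$ has a child $ch(\alpha,X,i)$ for every segment $X$ of $P_\alpha$ and $1\le i\le p$, with $\mathrm{avoid}(ch(\alpha,X,i))=\mathrm{avoid}(\alpha)\cup(X\cap U_i)$. The procedure $\mathrm{DecTree}(x,y,D)$ starts at the root $\alpha$ of $FT(x,y)$; while $D\cap P_\alpha\ne\varnothing$,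 it picks $f\in D\cap P_\alpha$ of highest level (ties broken arbitrarily) and replaces $\alpha$ by $ch(\alpha,\mathrm{seg}(f,P_\alpha),l(f))$; then it returns $|P_\alpha|$. *Auxiliary graph.* For $f\in D$ let $N(f)$ be the set of all vertices that, in some tree $T\in\bigcup_{i=1}^p\mathcal T_{U_{i+1}}(U_i)$ containing $f$, are the parent of $f$ or are a child of $f$ lying in $\mathrm{Trunk}(T)$ (the trunk is taken with respect to $U_i\setminus U_{i+1}$ for $T\in\mathcal T_{U_{i+1}}(U_i)$). $H$ is the complete graph on $V(H)=\bigl(\{u_0,v_0\}\cup\bigcup_{f\in D}N(f)\bigr)\setminus D$ in which going from $x$ to $y$ costs $\mathrm{DecTree}(x,y,D)$. For $u,v\in V(H)$ let $|\pi_H(u,v)|$ be the length of a shortest path from $u$ to $v$ in $H$; the oracle's answer to the query is $|\pi_H(u_0,v_0)|$. **Theorem.** For all choices above, $\mathrm{DecTree}(x,y,D)$ returns a value for all $x,y\in V(H)$ (it never has to descend below depth $d$), and for every pair $u,v\in V(H)$ $$\delta_{G-D}(u,v)\ \le\ |\pi_H(u,v)|\ \le\ (1+\epsilon)\,\delta_{G-D}(u,v).$$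 -/

import Mathlib

open scoped NNReal ENNReal

namespace VSDO

variable {V : Type*}

/-! ### Weighted graphs, lengths and distances

The input is a finite undirected graph `G` on the vertex type `V` whose edges carry the
weights `w : Sym2 V → ℝ≥0`. -/

/-- `G - R`, kept on the vertex type `V`: the vertices of `R` become isolated. -/
def delVerts (G : SimpleGraph V) (R : Set V) : SimpleGraph V where
  Adj a b := G.Adj a b ∧ a ∉ R ∧ b ∉ R
  symm := ⟨fun _ _ h => ⟨h.1.symm, h.2.2, h.2.1⟩⟩
  loopless := ⟨fun _ h => G.loopless.irrefl _ h.1⟩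

/-- The length `|P|` of a walk. -/
def len {G : SimpleGraph V} (w : Sym2 V → ℝ≥0) {a b : V} (P : G.Walk a b) : ℝ≥0 :=
  (P.edges.map w).sum

/-- The distance `δ_G(a, b)`; it is `⊤` if `a` and `b` are not connected. -/
noncomputable def gdist (G : SimpleGraph V) (w : Sym2 V → ℝ≥0) (a b : V) : ℝ≥0∞ :=
  ⨅ P : G.Walk a b, (len w P : ℝ≥0∞)

/-- `P` is a shortest path between its end points. -/
def IsShortestPath {G : SimpleGraph V} (w : Sym2 V → ℝ≥0) {a b : V} (P : G.Walk a b) : Prop :=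
  P.IsPath ∧ ∀ Q : G.Walk a b, len w P ≤ len w Q

/-! ### Source-restricted tree covers -/

/-- A rooted tree that is a subgraph of `G`. -/
structure RootedTree (G : SimpleGraph V) where
  tree : G.Subgraph
  isTree : tree.coe.IsTree
  root : V
  root_mem : root ∈ tree.verts

namespace RootedTree

variable {G : SimpleGraph V}

/-- The depth of `x` in `T`: its weighted distance in `T` from the root. -/
noncomputable def depth (T : RootedTree G) (w : Sym2 V → ℝ≥0) (x : V) : ℝ≥0∞ :=
  gdist T.tree.spanningCoe w T.root x

/-- `q` is the parent of `x` in `T`: it is the second vertex on the tree path from `x` to the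
root. -/
def IsParent (T : RootedTree G) (q x : V) : Prop :=
  ∃ (h : T.tree.spanningCoe.Adj x q) (P : T.tree.spanningCoe.Walk q T.root),
    (SimpleGraph.Walk.cons h P).IsPath

/-- The trunk vertices of `T` with respect to the source set `S`: those that lie on the tree
path between two vertices of `S`. -/
def trunk (T : RootedTree G) (S : Set V) : Set V :=
  {x | ∃ a ∈ S, ∃ b ∈ S, a ∈ T.tree.verts ∧ b ∈ T.tree.verts ∧
    ∃ P : T.tree.spanningCoe.Walk a b, P.IsPath ∧ x ∈ P.support}

/-- The pseudo-degree of `x`: its degree in the trunk, and `0` if `x` is not a trunk vertex. -/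
noncomputable def pdeg (T : RootedTree G) (S : Set V) (x : V) : ℕ :=
  {y | x ∈ T.trunk S ∧ y ∈ T.trunk S ∧ T.tree.Adj x y}.ncard

/-- `N_T(f)`: the parent of `f`, and those children of `f` that are trunk vertices. -/
def nbrs (T : RootedTree G) (S : Set V) (f : V) : Set V :=
  {y | T.IsParent y f ∨ (T.IsParent f y ∧ y ∈ T.trunk S)}

end RootedTree

/-- The parameter `k = ln n`, where `n` is the number of vertices of the input graph. -/
noncomputable def kParam (V : Type*) [Fintype V] : ℝ :=
  Real.log (Fintype.card V)

/-- An `S`-restricted tree cover of the graph `G`. -/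
structure TreeCover [Fintype V] (G : SimpleGraph V) (w : Sym2 V → ℝ≥0) (S : Set V) where
  /-- The trees `T(s)`, one for each `s ∈ S`. -/
  T : S → RootedTree G
  root_eq : ∀ s, (T s).root = s
  /-- If `u ∈ S` and `v` are connected, some tree contains both and the sum of their depths in
  it is at most `(2k - 1) δ(u, v)`. -/
  stretch : ∀ u ∈ S, ∀ v, G.Reachable u v → ∃ s,
    u ∈ (T s).tree.verts ∧ v ∈ (T s).tree.verts ∧
      (T s).depth w u + (T s).depth w v ≤ ENNReal.ofReal (2 * kParam V - 1) * gdist G w u v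
  /-- Every vertex is in at most `k n^{1/k} (ln n + 1)` trees. -/
  overlap : ∀ v, ({s | v ∈ (T s).tree.verts}.ncard : ℝ) ≤
    kParam V * (Fintype.card V : ℝ) ^ (1 / kParam V) * (Real.log (Fintype.card V) + 1)

/-- The choices that the construction of the oracle makes on the graph `G`. -/
structure Choices [Fintype V] (G : SimpleGraph V) (w : Sym2 V → ℝ≥0) where
  /-- `cover R S` is `𝒯_R(S)`, an `(S \ R)`-restricted tree cover of `G - R`;
  `𝒯(S)` is `cover ∅ S`. -/
  cover : ∀ R S : Set V, TreeCover (delVerts G R) w (S \ R)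
  /-- `path A x y` is `π_{G-A}(x, y)`, a shortest path in `G - A`, and `none` if there is none. -/
  path : ∀ (A : Set V) (x y : V), Option ((delVerts G A).Walk x y)
  path_none : ∀ A x y, path A x y = none ↔ ¬ (delVerts G A).Reachable x y
  path_shortest : ∀ A x y, ∀ P ∈ path A x y, IsShortestPath w P

/-! ### The high-degree hierarchy -/

/-- The degree threshold `s = 4 e d^{c+1} ln² n + 1`. -/
noncomputable def threshold (V : Type*) [Fintype V] (d : ℕ) (c : ℝ) : ℝ :=
  4 * Real.exp 1 * (d : ℝ) ^ (c + 1) * Real.log (Fintype.card V) ^ 2 + 1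

/-- `Hi` of a tree cover: the vertices of pseudo-degree larger than `t` in some tree. -/
def TreeCover.hi [Fintype V] {G : SimpleGraph V} {w : Sym2 V → ℝ≥0} {S : Set V}
    (C : TreeCover G w S) (t : ℝ) : Set V :=
  {x | ∃ s, t < ((C.T s).pdeg S x : ℝ)}

namespace Choices

variable [Fintype V] {G : SimpleGraph V} {w : Sym2 V → ℝ≥0}

/-- The children of the node `U` of the hierarchy tree are `W_1, …, W_d`, where `W_0 = ∅` and
`W_{i+1} = W_i ∪ Hi(𝒯_{W_i}(U))`; so `W_1 = Hi(𝒯(U))`. -/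
noncomputable def child (O : Choices G w) (d : ℕ) (c : ℝ) (U : Set V) : ℕ → Set V
  | 0 => ∅
  | i + 1 => child O d c U i ∪ (O.cover (child O d c U i) U).hi (threshold V d c)

/-- The least `j ∈ [0, d]` with `D ∩ (W_{j+1} \ W_j) = ∅`, where `W_{d+1} = W_d`. -/
noncomputable def nextIndex (O : Choices G w) (d : ℕ) (c : ℝ) (D U : Set V) : ℕ :=
  sInf {j | j ≤ d ∧ D ∩ (O.child d c U (min (j + 1) d) \ O.child d c U j) = ∅}

open Classical in
/-- At most `m` rounds of the path finding algorithm for `D`, started at the node `U`. A node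
`U` is a leaf of the hierarchy tree if `Hi(𝒯(U)) = W_1` is empty. -/
noncomputable def pathFrom (O : Choices G w) (d : ℕ) (c : ℝ) (D : Set V) :
    ℕ → Set V → List (Set V)
  | 0, U => [U]
  | m + 1, U =>
    if O.child d c U 1 = ∅ then [U]
    else if O.nextIndex d c D U = 0 then [U]
    else U :: pathFrom O d c D m (O.child d c U (O.nextIndex d c D U))

/-- The path `U_1, …, U_p` of the hierarchy tree that the path finding algorithm returns for
`D`. It makes at most `⌊(1/c) log_d n⌋` rounds and starts at the root `U_1 = V`. -/
noncomputable def hpath (O : Choices G w) (d : ℕ) (c : ℝ) (D : Set V) : List (Set V) :=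
  O.pathFrom d c D ⌊1 / c * Real.logb d (Fintype.card V)⌋₊ Set.univ

/-- The set `U_i` for `1 ≤ i ≤ p`; the other `U_i`, in particular `U_{p+1}`, are empty. -/
noncomputable def U (O : Choices G w) (d : ℕ) (c : ℝ) (D : Set V) (i : ℕ) : Set V :=
  (∅ :: O.hpath d c D).getD i ∅

/-- The level of `x`: the largest `i` such that `x ∈ U_i`. -/
noncomputable def level (O : Choices G w) (d : ℕ) (c : ℝ) (D : Set V) (x : V) : ℕ :=
  sSup {i | x ∈ O.U d c D i}

end Choices

/-! ### Segments of a path -/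

section Segments

variable [DecidableEq V] {G : SimpleGraph V}

/-- `|P[x, t]|` for a vertex `t` of a path `P` from `x` to `y`. -/
noncomputable def lenTo (w : Sym2 V → ℝ≥0) {x y : V} (P : G.Walk x y) (t : V) : ℝ :=
  if h : t ∈ P.support then len w (P.takeUntil t h) else 0

/-- `|P[t, y]|` for a vertex `t` of a path `P` from `x` to `y`. -/
noncomputable def lenFrom (w : Sym2 V → ℝ≥0) {x y : V} (P : G.Walk x y) (t : V) : ℝ :=
  if h : t ∈ P.support then len w (P.dropUntil t h) else 0

/-- Two inner vertices of `P` are in the same `e`-segment of `P`. -/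
def SameSegment (w : Sym2 V → ℝ≥0) (e : ℝ) {x y : V} (P : G.Walk x y) (s t : V) : Prop :=
  (lenTo w P s ≤ len w P / 2 ∧ lenTo w P t ≤ len w P / 2 ∧
    ⌊Real.logb (1 + e) (lenTo w P s)⌋ = ⌊Real.logb (1 + e) (lenTo w P t)⌋) ∨
  (lenFrom w P s < len w P / 2 ∧ lenFrom w P t < len w P / 2 ∧
    ⌊Real.logb (1 + e) (lenFrom w P s)⌋ = ⌊Real.logb (1 + e) (lenFrom w P t)⌋)

/-- The vertices of `seg(f, P)`, for an inner vertex `f` of `P`. -/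
def seg (w : Sym2 V → ℝ≥0) (e : ℝ) {x y : V} (f : V) (P : G.Walk x y) : Set V :=
  {t | t ∈ P.support ∧ t ≠ x ∧ t ≠ y ∧ SameSegment w e P f t}

end Segments

/-- `ε₁ = ε / (2 + ε)` and `ε₂ = ε₁ / (2k - 1)`. -/
noncomputable def eps2 (V : Type*) [Fintype V] (ε : ℝ) : ℝ :=
  ε / (2 + ε) / (2 * kParam V - 1)

/-! ### Decision trees -/

/-- A node of a decision tree `FT(x, y)` is described by the sequence of pairs `(X, i)` that
leads to it from the root, the last pair first: `ch(α, X, i)` is `(X, i) :: α`. -/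
abbrev Node (V : Type*) := List (Set V × ℕ)

namespace Choices

variable [Fintype V] {G : SimpleGraph V} {w : Sym2 V → ℝ≥0}

/-- `avoid(α)`. -/
noncomputable def avoid (O : Choices G w) (d : ℕ) (c : ℝ) (D : Set V) : Node V → Set V
  | [] => ∅
  | (X, i) :: α => avoid O d c D α ∪ (X ∩ O.U d c D i)

/-- The failed vertices on the path `P_α` stored at the node `α` of `FT(x, y)`. -/
noncomputable def hit (O : Choices G w) (d : ℕ) (c : ℝ) (D : Set V) (x y : V) (α : Node V) :
    Set V :=
  match O.path (O.avoid d c D α) x y with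
  | none => ∅
  | some P => {f | f ∈ D ∧ f ∈ P.support}

/-- The length `|P_α|`, which is `⊤` if `x` and `y` are not connected in `G - avoid(α)`. -/
noncomputable def storedLen (O : Choices G w) (d : ℕ) (c : ℝ) (D : Set V) (x y : V)
    (α : Node V) : ℝ≥0∞ :=
  match O.path (O.avoid d c D α) x y with
  | none => ⊤
  | some P => len w P

/-- The child `ch(α, seg(f, P_α), l(f))` of the node `α` of `FT(x, y)`. -/
noncomputable def descend [DecidableEq V] (O : Choices G w) (d : ℕ) (c ε : ℝ) (D : Set V)
    (x y : V) (α : Node V) (f : V) : Node V :=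
  match O.path (O.avoid d c D α) x y with
  | none => α
  | some P => (seg w (eps2 V ε) f P, O.level d c D f) :: α

/-- `pick x y α` is the failed vertex that `DecTree(x, y, D)` selects at the node `α`: a vertex
of `D ∩ P_α` of highest level, ties being broken arbitrarily. -/
def IsPick (O : Choices G w) (d : ℕ) (c : ℝ) (D : Set V) (pick : V → V → Node V → V) : Prop :=
  ∀ x y α, (O.hit d c D x y α).Nonempty →
    pick x y α ∈ O.hit d c D x y α ∧
      ∀ g ∈ O.hit d c D x y α, O.level d c D g ≤ O.level d c D (pick x y α)

open Classical in
/-- The loop of `DecTree`, at a node `α` below which the decision tree has `m` more layers. The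
result is `none` if the loop would have to descend from a node of the last layer. -/
noncomputable def decTreeLoop [DecidableEq V] (O : Choices G w) (d : ℕ) (c ε : ℝ) (D : Set V)
    (pick : V → V → Node V → V) (x y : V) : ℕ → Node V → Option ℝ≥0∞
  | 0, α => if O.hit d c D x y α = ∅ then some (O.storedLen d c D x y α) else none
  | m + 1, α =>
    if O.hit d c D x y α = ∅ then some (O.storedLen d c D x y α)
    else decTreeLoop O d c ε D pick x y m (O.descend d c ε D x y α (pick x y α))

/-- `DecTree(x, y, D)`: the decision tree has depth `d`, and the loop starts at its root. -/
noncomputable def decTree [DecidableEq V] (O : Choices G w) (d : ℕ) (c ε : ℝ) (D : Set V)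
    (pick : V → V → Node V → V) (x y : V) : Option ℝ≥0∞ :=
  O.decTreeLoop d c ε D pick x y d []

/-! ### The auxiliary graph -/

/-- `N(f)`: the union of `N_T(f)` over all trees `T` that contain `f` and belong to one of the
covers `𝒯_{U_{i+1}}(U_i)`, `1 ≤ i ≤ p`. -/
def N (O : Choices G w) (d : ℕ) (c : ℝ) (D : Set V) (f : V) : Set V :=
  {y | ∃ i, 1 ≤ i ∧ i ≤ (O.hpath d c D).length ∧
    ∃ s, f ∈ ((O.cover (O.U d c D (i + 1)) (O.U d c D i)).T s).tree.verts ∧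
      y ∈ ((O.cover (O.U d c D (i + 1)) (O.U d c D i)).T s).nbrs
        (O.U d c D i \ O.U d c D (i + 1)) f}

/-- The vertex set `V(H)` of the auxiliary graph for the query `(u, v, D)`. -/
def VH (O : Choices G w) (d : ℕ) (c : ℝ) (D : Set V) (u v : V) : Set V :=
  ({u, v} ∪ ⋃ f ∈ D, O.N d c D f) \ D

end Choices

/-- The distance from `a` to `b` in the complete graph on the vertex set `A` in which going from
`x` to `y` costs `wt x y`. -/
noncomputable def auxDist (A : Set V) (wt : V → V → ℝ≥0∞) (a b : A) : ℝ≥0∞ :=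
  ⨅ P : (⊤ : SimpleGraph A).Walk a b, (P.darts.map fun e => wt e.fst e.snd).sum


/-! ### Tree covers exist

What follows proves that every input graph with at least three vertices has tree covers
in the above sense, so that there is an element of `Choices G w`. -/

section Dist
variable {G : SimpleGraph V} {w : Sym2 V → ℝ≥0}

lemma gdist_self (a : V) : gdist G w a a = 0 := by
  refine le_antisymm ((iInf_le _ (SimpleGraph.Walk.nil)).trans ?_) zero_le
  simp [len]

lemma gdist_comm (a b : V) : gdist G w a b = gdist G w b a := by
  have key : ∀ a b : V, gdist G w a b ≤ gdist G w b a := by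
    intro a b
    refine le_iInf fun P => (iInf_le _ P.reverse).trans ?_
    simp [len]
  exact le_antisymm (key a b) (key b a)

lemma gdist_triangle (a b c : V) : gdist G w a c ≤ gdist G w a b + gdist G w b c := by
  unfold gdist
  rw [ENNReal.iInf_add]
  refine le_iInf fun P => ?_
  rw [ENNReal.add_iInf]
  refine le_iInf fun Q => (iInf_le _ (P.append Q)).trans ?_
  simp [len]

lemma gdist_adj {a b : V} (h : G.Adj a b) : gdist G w a b ≤ w s(a, b) := by
  refine (iInf_le _ (SimpleGraph.Walk.cons h .nil)).trans ?_
  simp [len]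

lemma gdist_lt_top {a b : V} : gdist G w a b < ⊤ ↔ G.Reachable a b := by
  constructor
  · intro h
    obtain ⟨P, -⟩ := iInf_lt_iff.1 h
    exact ⟨P⟩
  · rintro ⟨P⟩
    exact (iInf_le _ P).trans_lt ENNReal.coe_lt_top

lemma exists_shortest [Finite V] {a b : V} (h : G.Reachable a b) :
    ∃ P : G.Walk a b, IsShortestPath w P := by
  classical
  have := Fintype.ofFinite V
  obtain ⟨Q⟩ := h
  have : Nonempty (G.Path a b) := ⟨Q.toPath⟩
  obtain ⟨P, hP⟩ := Finite.exists_min (fun P : G.Path a b => len w P.1)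
  refine ⟨P.1, P.2, fun Q => (hP Q.toPath).trans ?_⟩
  exact List.Sublist.sum_le_sum ((Q.edges_bypass_sublist_edges).map w) (by simp)

lemma IsShortestPath.gdist_eq {a b : V} {P : G.Walk a b} (hP : IsShortestPath w P) :
    gdist G w a b = len w P :=
  le_antisymm (iInf_le _ P) (le_iInf fun Q => by exact_mod_cast hP.2 Q)

lemma exists_next [Finite V] {a b : V} (h : G.Reachable a b) (hab : a ≠ b) :
    ∃ c, G.Adj a c ∧ gdist G w a b = w s(a, c) + gdist G w c b := by
  obtain ⟨P, hP⟩ := exists_shortest (w := w) h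
  have hd := hP.gdist_eq
  cases P with
  | nil => exact absurd rfl hab
  | cons hac Q =>
    rename_i c
    refine ⟨c, hac, le_antisymm ?_ ?_⟩
    · exact (gdist_triangle a c b).trans (by gcongr; exact gdist_adj hac)
    · rw [hd]
      have : gdist G w c b ≤ len w Q := iInf_le _ Q
      simpa [len] using (add_le_add_right this (w s(a, c) : ℝ≥0∞))

/-- A shortest path tree on a set `C`, given by parent pointers. -/
lemma exists_tree [Finite V] (hw : ∀ e ∈ G.edgeSet, 0 < w e) (r : V) (C : Set V) (hr : r ∈ C)
    (par : V → V)
    (hpar : ∀ x ∈ C, x ≠ r → par x ∈ C ∧ G.Adj x (par x) ∧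
      gdist G w x r = w s(x, par x) + gdist G w (par x) r)
    (hreach : ∀ x ∈ C, gdist G w x r < ⊤) :
    ∃ T : RootedTree G, T.root = r ∧ T.tree.verts = C ∧
      ∀ x ∈ C, T.depth w x ≤ gdist G w r x := by
  classical
  let S : G.Subgraph :=
    { verts := C
      Adj a b := (a ∈ C ∧ a ≠ r ∧ b = par a) ∨ (b ∈ C ∧ b ≠ r ∧ a = par b)
      adj_sub := by
        rintro a b (⟨h1, h2, rfl⟩ | ⟨h1, h2, rfl⟩)
        · exact (hpar _ h1 h2).2.1
        · exact (hpar _ h1 h2).2.1.symm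
      edge_vert := by
        rintro a b (⟨h1, h2, rfl⟩ | ⟨h1, h2, rfl⟩)
        · exact h1
        · exact (hpar _ h1 h2).1
      symm := ⟨by rintro a b (h | h); exacts [Or.inr h, Or.inl h]⟩ }
  have hlt : ∀ x ∈ C, x ≠ r → gdist G w (par x) r < gdist G w x r := by
    intro x hx hxr
    obtain ⟨h1, h2, h3⟩ := hpar x hx hxr
    rw [h3, add_comm]
    refine ENNReal.lt_add_right (hreach _ h1).ne ?_
    have := hw _ (G.mem_edgeSet.2 h2)
    exact_mod_cast this.ne'
  have wf : WellFounded (InvImage (· < ·) fun x : V => gdist G w x r) :=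
    Finite.wellFounded_of_trans_of_irrefl _
  have hconn : ∀ x, (hx : x ∈ C) → S.coe.Reachable ⟨x, hx⟩ ⟨r, hr⟩ := by
    intro x
    induction x using wf.induction with
    | _ x ih =>
      intro hx
      by_cases hxr : x = r
      · subst hxr; exact .rfl
      · have h1 := (hpar x hx hxr).1
        have : S.coe.Adj ⟨x, hx⟩ ⟨par x, h1⟩ := Or.inl ⟨hx, hxr, rfl⟩
        exact this.reachable.trans (ih (par x) (hlt x hx hxr) h1)
  have hC : S.coe.Connected := by
    have : Nonempty S.verts := ⟨⟨r, hr⟩⟩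
    exact ⟨fun a b => (hconn a.1 a.2).trans (hconn b.1 b.2).symm⟩
  have hdep : ∀ x ∈ C, gdist S.spanningCoe w x r ≤ gdist G w x r := by
    intro x
    induction x using wf.induction with
    | _ x ih =>
      intro hx
      by_cases hxr : x = r
      · subst hxr; simp [gdist_self]
      · obtain ⟨h1, h2, h3⟩ := hpar x hx hxr
        have hadj : S.spanningCoe.Adj x (par x) := Or.inl ⟨hx, hxr, rfl⟩
        rw [h3]
        exact (gdist_triangle x (par x) r).trans
          (add_le_add (gdist_adj hadj) (ih _ (hlt x hx hxr) h1))
  refine ⟨⟨S, ?_, r, hr⟩, rfl, rfl, fun x hx => ?_⟩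
  · rw [SimpleGraph.isTree_iff_connected_and_card]
    refine ⟨hC, le_antisymm ?_ hC.card_vert_le_card_edgeSet_add_one⟩
    let f : {x : S.verts // x ≠ ⟨r, hr⟩} → Sym2 S.verts := fun x =>
      s(x.1, ⟨par x.1.1, (hpar x.1.1 x.1.2 (fun h => x.2 (Subtype.ext h))).1⟩)
    have hsub : S.coe.edgeSet ⊆ Set.range f := by
      intro e
      induction e with
      | _ a b =>
        rintro (⟨h1, h2, h3⟩ | ⟨h1, h2, h3⟩)
        · refine ⟨⟨a, fun h => h2 (congrArg Subtype.val h)⟩, ?_⟩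
          have e1 : (⟨par a.1, (hpar a.1 a.2 h2).1⟩ : S.verts) = b := Subtype.ext h3.symm
          simp only [f]
          rw [e1]
        · refine ⟨⟨b, fun h => h2 (congrArg Subtype.val h)⟩, ?_⟩
          have e1 : (⟨par b.1, (hpar b.1 b.2 h2).1⟩ : S.verts) = a := Subtype.ext h3.symm
          simp only [f]
          rw [e1, Sym2.eq_swap]
    have h1 : Nat.card S.coe.edgeSet ≤ Nat.card {x : S.verts // x ≠ ⟨r, hr⟩} :=
      (Nat.card_mono (Set.toFinite _) hsub).trans (Finite.card_range_le f)
    have h2 : Nat.card {x : S.verts // x ≠ ⟨r, hr⟩} < Nat.card S.verts :=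
      Finite.card_subtype_lt (x := ⟨r, hr⟩) (by simp)
    omega
  · rw [RootedTree.depth, gdist_comm, gdist_comm r x]
    exact hdep x hx
end Dist
section Cover

lemma exists_lowest {β : Type*} [LinearOrder β] (A : Finset V) (f : V → β) (b : ℕ)
    (hb : b ≤ A.card) : ∃ N ⊆ A, N.card = b ∧ ∀ x ∈ N, ∀ y ∈ A, y ∉ N → f x ≤ f y := by
  classical
  induction b with
  | zero => exact ⟨∅, by simp⟩
  | succ b ih =>
    obtain ⟨N, hN, hc, hlow⟩ := ih (by omega)
    have hne : (A \ N).Nonempty := by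
      rw [← Finset.card_pos, Finset.card_sdiff_of_subset hN]; omega
    obtain ⟨z, hz, hmin⟩ := Finset.exists_min_image (A \ N) f hne
    rw [Finset.mem_sdiff] at hz
    refine ⟨insert z N, ?_, ?_, ?_⟩
    · exact Finset.insert_subset hz.1 hN
    · rw [Finset.card_insert_of_notMem hz.2, hc]
    · intro x hx y hy hyN
      rw [Finset.mem_insert, not_or] at hyN
      rcases Finset.mem_insert.1 hx with rfl | hx
      · exact hmin y (Finset.mem_sdiff.2 ⟨hy, hyN.2⟩)
      · exact hlow x hx y hy hyN.2

open Classical in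
lemma exists_partial_hitting {ι : Type*} [Fintype ι] (A : Finset V) (N : ι → Finset V) (b : ℕ)
    (hb : 1 ≤ b) (hA : b ≤ A.card) (hN : ∀ i, N i ⊆ A ∧ (N i).card = b) (t : ℕ) :
    ∃ B ⊆ A, B.card ≤ t ∧
      ((Finset.univ.filter fun i => Disjoint B (N i)).card : ℝ) ≤
        Fintype.card ι * (1 - (b : ℝ) / A.card) ^ t := by
  have hApos : (0 : ℝ) < A.card := by exact_mod_cast (by omega : 0 < A.card)
  induction t with
  | zero => exact ⟨∅, by simp⟩
  | succ t ih =>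
    obtain ⟨B, hBA, hBt, hB⟩ := ih
    set F := Finset.univ.filter fun i => Disjoint B (N i) with hF
    have hAne : A.Nonempty := Finset.card_pos.1 (by omega)
    have hsum : ∑ x ∈ A, (F.filter fun i => x ∈ N i).card = F.card * b := by
      have := Finset.sum_card_bipartiteAbove_eq_sum_card_bipartiteBelow
        (s := A) (t := F) (fun x i => x ∈ N i)
      unfold Finset.bipartiteAbove Finset.bipartiteBelow at this
      rw [this, ← smul_eq_mul, ← Finset.sum_const]
      refine Finset.sum_congr rfl fun i _ => ?_
      rw [← (hN i).2]
      congr 1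
      ext x
      simp only [Finset.mem_filter, and_iff_right_iff_imp]
      exact fun h => (hN i).1 h
    obtain ⟨z, hzA, hz⟩ : ∃ z ∈ A, (F.card * b / A.card : ℝ) ≤
        ((F.filter fun i => z ∈ N i).card : ℝ) := by
      refine Finset.exists_le_of_sum_le hAne ?_
      rw [Finset.sum_const, nsmul_eq_mul, mul_div_cancel₀ _ hApos.ne']
      exact_mod_cast hsum.ge
    refine ⟨insert z B, Finset.insert_subset hzA hBA, (Finset.card_insert_le _ _).trans (by omega),
      ?_⟩
    have hsplit : (Finset.univ.filter fun i => Disjoint (insert z B) (N i)) =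
        F.filter fun i => z ∉ N i := by
      ext i
      simp [hF, Finset.disjoint_insert_left, and_comm]
    have hcard := Finset.card_filter_add_card_filter_not (s := F) (fun i => z ∈ N i)
    have hcard' : ((F.filter fun i => z ∈ N i).card : ℝ) +
      ((F.filter fun i => z ∉ N i).card : ℝ) = F.card := by exact_mod_cast hcard
    rw [hsplit]
    have hfac : 0 ≤ 1 - (b : ℝ) / A.card := by
      rw [sub_nonneg, div_le_one hApos]; exact_mod_cast hA
    calc ((F.filter fun i => z ∉ N i).card : ℝ)
        ≤ F.card - F.card * b / A.card := by linarith
      _ = F.card * (1 - (b : ℝ) / A.card) := by ring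
      _ ≤ (Fintype.card ι * (1 - (b : ℝ) / A.card) ^ t) * (1 - (b : ℝ) / A.card) := by gcongr
      _ = _ := by rw [pow_succ]; ring

lemma exists_hitting {ι : Type*} [Fintype ι] [Nonempty ι] (A : Finset V) (N : ι → Finset V)
    (b : ℕ) (hb : 1 ≤ b) (hA : b ≤ A.card) (hN : ∀ i, N i ⊆ A ∧ (N i).card = b) :
    ∃ B ⊆ A, (B.card : ℝ) ≤ A.card / b * (Real.log (Fintype.card ι) + 1) ∧
      ∀ i, ∃ z ∈ B, z ∈ N i := by
  classical
  have hApos : (0 : ℝ) < A.card := by exact_mod_cast (by omega : 0 < A.card)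
  have hbpos : (0 : ℝ) < b := by exact_mod_cast hb
  have hι : (0 : ℝ) < Fintype.card ι := by exact_mod_cast Fintype.card_pos
  set L := Real.log (Fintype.card ι) with hL
  have hL0 : 0 ≤ L := Real.log_nonneg (by exact_mod_cast Fintype.card_pos (α := ι))
  set t := ⌊A.card / b * L⌋₊ + 1 with ht
  have ht1 : A.card / b * L < t := by
    rw [ht]; push_cast; exact Nat.lt_floor_add_one _
  have ht2 : (t : ℝ) ≤ A.card / b * (L + 1) := by
    have h1 : (1 : ℝ) ≤ A.card / b := by rw [le_div_iff₀ hbpos]; simpa using hA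
    have h2 := Nat.floor_le (a := A.card / b * L) (by positivity)
    rw [ht]; push_cast; linarith
  obtain ⟨B, hBA, hBt, hB⟩ := exists_partial_hitting A N b hb hA hN t
  refine ⟨B, hBA, le_trans (by exact_mod_cast hBt) ht2, ?_⟩
  have hlt : (Fintype.card ι : ℝ) * (1 - (b : ℝ) / A.card) ^ t < 1 := by
    have hfac : 0 ≤ 1 - (b : ℝ) / A.card := by
      rw [sub_nonneg, div_le_one hApos]; exact_mod_cast hA
    have h1 : (1 - (b : ℝ) / A.card) ^ t ≤ Real.exp (-((b : ℝ) / A.card) * t) := by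
      rw [mul_comm, Real.exp_nat_mul]
      gcongr
      linarith [Real.add_one_le_exp (-((b : ℝ) / A.card))]
    have h2 : Real.exp (-((b : ℝ) / A.card) * t) < Real.exp (-L) := by
      rw [Real.exp_lt_exp, neg_mul, neg_lt_neg_iff]
      calc L = (b : ℝ) / A.card * (A.card / b * L) := by field_simp
        _ < _ := by gcongr
    calc _ < (Fintype.card ι : ℝ) * Real.exp (-L) := by
          gcongr; exact h1.trans_lt h2
      _ = 1 := by rw [Real.exp_neg, hL, Real.exp_log hι, mul_inv_cancel₀ hι.ne']
  intro i
  have h0 : (Finset.univ.filter fun i => Disjoint B (N i)).card = 0 := by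
    have := hB.trans_lt hlt
    have : (Finset.univ.filter fun i => Disjoint B (N i)).card < 1 := by exact_mod_cast this
    omega
  rw [Finset.card_eq_zero] at h0
  have : i ∉ Finset.univ.filter fun i => Disjoint B (N i) := by simp [h0]
  simpa [Finset.not_disjoint_iff] using this

open Classical in
/-- One sampling step: `B` is a sparse subset of `A` that hits all small balls. -/
lemma exists_sample [Fintype V] [Nonempty V] (δ : V → V → ℝ≥0∞) (A : Finset V) (q : ℝ)
    (hq : 0 < q) :
    ∃ B ⊆ A, (B.card : ℝ) ≤ A.card / q ∧
      ∀ v, ((A.filter fun x => ∀ z ∈ B, δ v x < δ v z).card : ℝ) ≤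
        q * (Real.log (Fintype.card V) + 1) := by
  set L := Real.log (Fintype.card V) with hL
  have hL0 : 0 ≤ L := Real.log_nonneg (by exact_mod_cast Fintype.card_pos (α := V))
  have hx : 0 < q * (L + 1) := by positivity
  set b := ⌈q * (L + 1)⌉₊ with hb
  have hb1 : 1 ≤ b := Nat.one_le_iff_ne_zero.2 (Nat.ceil_pos.2 hx).ne'
  have hb2 : (b : ℝ) < q * (L + 1) + 1 := Nat.ceil_lt_add_one hx.le
  have hb3 : q * (L + 1) ≤ b := Nat.le_ceil _
  by_cases hA : b ≤ A.card
  · choose N hN hNc hlow using fun v => exists_lowest A (δ v) b hA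
    obtain ⟨B, hBA, hBc, hhit⟩ := exists_hitting A N b hb1 hA fun v => ⟨hN v, hNc v⟩
    refine ⟨B, hBA, hBc.trans ?_, fun v => ?_⟩
    · have hbpos : (0 : ℝ) < b := by exact_mod_cast hb1
      rw [div_mul_eq_mul_div, div_le_div_iff₀ hbpos hq]
      have : (0 : ℝ) ≤ A.card := by positivity
      nlinarith
    · obtain ⟨z, hzB, hzN⟩ := hhit v
      have hsub : (A.filter fun x => ∀ z ∈ B, δ v x < δ v z) ⊆ (N v).erase z := by
        intro x hxm
        rw [Finset.mem_filter] at hxm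
        have hlt := hxm.2 z hzB
        rw [Finset.mem_erase]
        refine ⟨fun h => ?_, ?_⟩
        · subst h; exact lt_irrefl _ hlt
        · by_contra hxN
          exact absurd (hlow v z hzN x hxm.1 hxN) (not_le.2 hlt)
      have := Finset.card_le_card hsub
      rw [Finset.card_erase_of_mem hzN, hNc] at this
      have h3 : ((A.filter fun x => ∀ z ∈ B, δ v x < δ v z).card : ℝ) + 1 ≤ b := by
        exact_mod_cast (by omega : (A.filter fun x => ∀ z ∈ B, δ v x < δ v z).card + 1 ≤ b)
      linarith
  · refine ⟨∅, by simp, by simp; positivity, fun v => ?_⟩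
    have h3 : (A.card : ℝ) + 1 ≤ b := by exact_mod_cast (by omega : A.card + 1 ≤ b)
    simp only [Finset.notMem_empty, false_imp_iff, implies_true, Finset.filter_true]
    linarith

open Classical in
lemma exists_seq [Fintype V] [Nonempty V] (δ : V → V → ℝ≥0∞) (S : Finset V) (q : ℝ)
    (hq : 0 < q) (K : ℕ) (hK : 1 ≤ K) :
    ∃ A : ℕ → Finset V, A 0 = S ∧ (∀ i, A (i + 1) ⊆ A i) ∧ A K = ∅ ∧
      (∀ i, i + 1 < K → ∀ v, (((A i).filter fun x => ∀ z ∈ A (i + 1), δ v x < δ v z).card : ℝ) ≤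
        q * (Real.log (Fintype.card V) + 1)) ∧
      ((A (K - 1)).card : ℝ) ≤ S.card / q ^ (K - 1) := by
  choose f hf1 hf2 hf3 using fun A => exists_sample δ A q hq
  let A : ℕ → Finset V := fun i => f^[i] S
  have hA : ∀ i, A (i + 1) = f (A i) := fun i => Function.iterate_succ_apply' f i S
  have hsize : ∀ i, ((A i).card : ℝ) ≤ S.card / q ^ i := by
    intro i
    induction i with
    | zero => simp [A]
    | succ i ih =>
      rw [hA]
      refine (hf2 _).trans ?_
      rw [pow_succ, ← div_div]
      gcongr
  refine ⟨fun i => if i < K then A i else ∅, ?_, ?_, ?_, ?_, ?_⟩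
  · dsimp only
    rw [if_pos (by omega)]; rfl
  · intro i
    dsimp only
    by_cases h : i + 1 < K
    · rw [if_pos h, if_pos (by omega), hA]; exact hf1 _
    · rw [if_neg h]; simp
  · simp
  · intro i hi v
    have := hf3 (A i) v
    simp only [if_pos hi, if_pos (by omega : i < K), hA]
    convert this
  · dsimp only
    rw [if_pos (by omega)]
    exact hsize _
end Cover
section Cover2
variable {G : SimpleGraph V} {w : Sym2 V → ℝ≥0}

lemma gdist_pos [Finite V] (hw : ∀ e ∈ G.edgeSet, 0 < w e) {a b : V} (hab : a ≠ b) :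
    0 < gdist G w a b := by
  by_cases h : G.Reachable a b
  · obtain ⟨c, hc, hd⟩ := exists_next (w := w) h hab
    rw [hd]
    exact lt_of_lt_of_le (by exact_mod_cast hw _ (G.mem_edgeSet.2 hc)) le_self_add
  · rw [← gdist_lt_top (w := w), not_lt, top_le_iff] at h
    rw [h]; exact ENNReal.zero_lt_top

/-- The cluster of `s`, cut off by the set `B`. -/
def cluster (G : SimpleGraph V) (w : Sym2 V → ℝ≥0) (B : Finset V) (s : V) : Set V :=
  {x | gdist G w x s < ⊤ ∧ ∀ z ∈ B, gdist G w x s < gdist G w x z}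

lemma exists_cluster_tree [Finite V] (hw : ∀ e ∈ G.edgeSet, 0 < w e) (B : Finset V) (s : V)
    (hs : s ∉ B) :
    ∃ T : RootedTree G, T.root = s ∧ T.tree.verts = cluster G w B s ∧
      ∀ x ∈ cluster G w B s, T.depth w x ≤ gdist G w s x := by
  classical
  have hex : ∀ x, ∃ c, x ∈ cluster G w B s → x ≠ s →
      G.Adj x c ∧ gdist G w x s = w s(x, c) + gdist G w c s := by
    intro x
    by_cases h : x ∈ cluster G w B s ∧ x ≠ s
    · obtain ⟨c, hc⟩ := exists_next (w := w) (gdist_lt_top.1 h.1.1) h.2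
      exact ⟨c, fun _ _ => hc⟩
    · exact ⟨x, fun h1 h2 => absurd ⟨h1, h2⟩ h⟩
  choose par hpar using hex
  refine exists_tree hw s _ ?_ par ?_ fun x hx => hx.1
  · refine ⟨by simp [gdist_self], fun z hz => ?_⟩
    rw [gdist_self]
    exact gdist_pos hw (fun h => hs (h ▸ hz))
  · intro x hx hxs
    obtain ⟨h1, h2⟩ := hpar x hx hxs
    refine ⟨⟨?_, fun z hz => ?_⟩, h1, h2⟩
    · refine lt_of_le_of_lt ?_ hx.1
      rw [h2]; exact le_add_self
    · by_contra hle
      rw [not_lt] at hle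
      have h3 := hx.2 z hz
      rw [h2] at h3
      refine absurd h3 (not_lt.2 ?_)
      refine (gdist_triangle x (par x) z).trans ?_
      exact add_le_add (gdist_adj h1) hle

open Classical in
lemma exists_cover_of_seq [Fintype V] (hw : ∀ e ∈ G.edgeSet, 0 < w e) (K : ℕ) (A : ℕ → Finset V)
    (hA : ∀ i, A (i + 1) ⊆ A i) (hK : A K = ∅) :
    ∃ T : (A 0 : Set V) → RootedTree G, (∀ s, (T s).root = s) ∧
      (∀ u ∈ A 0, ∀ v, G.Reachable u v → ∃ s, u ∈ (T s).tree.verts ∧ v ∈ (T s).tree.verts ∧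
        (T s).depth w u + (T s).depth w v ≤ ((2 * (K - 1) + 1 : ℕ) : ℝ≥0∞) * gdist G w u v) ∧
      ∀ v, {s | v ∈ (T s).tree.verts}.ncard ≤ ∑ i ∈ Finset.range K,
        ((A i).filter fun x => ∀ z ∈ A (i + 1), gdist G w v x < gdist G w v z).card := by
  have hanti : Antitone A := antitone_nat_of_succ_le hA
  let rk : V → ℕ := fun x => Nat.findGreatest (fun i => x ∈ A i) K
  have hrk : ∀ x ∈ A 0, x ∈ A (rk x) := fun x hx =>
    Nat.findGreatest_spec (P := fun i => x ∈ A i) (Nat.zero_le K) hx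
  have hrkK : ∀ x ∈ A 0, rk x < K := by
    intro x hx
    refine lt_of_le_of_ne (Nat.findGreatest_le K) fun h => ?_
    have := hrk x hx
    rw [h, hK] at this
    simp at this
  have hrkle : ∀ x i, x ∈ A i → i ≤ rk x := by
    intro x i hx
    refine Nat.le_findGreatest ?_ hx
    by_contra h
    have := hanti (by omega : K ≤ i) hx
    rw [hK] at this
    simp at this
  have hrk' : ∀ x, x ∉ A (rk x + 1) := fun x hx => by
    have := hrkle x _ hx; omega
  choose T hT1 hT2 hT3 using fun s : (A 0 : Set V) =>
    exists_cluster_tree hw (A (rk s.1 + 1)) s.1 (hrk' s.1)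
  refine ⟨T, hT1, ?_, ?_⟩
  · have key : ∀ m : ℕ, ∀ a b x, x ∈ A 0 → K ≤ rk x + m → G.Reachable a b →
        a ∈ cluster G w (A (rk x + 1)) x → gdist G w a x ≤ (rk x : ℝ≥0∞) * gdist G w a b →
        ∃ y, ∃ hy : y ∈ A 0, a ∈ cluster G w (A (rk y + 1)) y ∧
          b ∈ cluster G w (A (rk y + 1)) y ∧
          gdist G w a y + gdist G w b y ≤ ((2 * (K - 1) + 1 : ℕ) : ℝ≥0∞) * gdist G w a b := by
      intro m
      induction m with
      | zero =>
        intro a b x hx hm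
        have := hrkK x hx
        omega
      | succ m ih =>
        intro a b x hx hm hab hax hd
        have hab' := (gdist_lt_top (w := w)).2 hab
        have hbx : gdist G w b x ≤ gdist G w a b + gdist G w a x := by
          rw [gdist_comm a b]; exact gdist_triangle b a x
        have hbx' : gdist G w b x < ⊤ := hbx.trans_lt (ENNReal.add_lt_top.2 ⟨hab', hax.1⟩)
        by_cases hb : b ∈ cluster G w (A (rk x + 1)) x
        · refine ⟨x, hx, hax, hb, ?_⟩
          have hr : rk x ≤ K - 1 := by have := hrkK x hx; omega
          calc gdist G w a x + gdist G w b x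
              ≤ rk x * gdist G w a b + (gdist G w a b + rk x * gdist G w a b) := by
                gcongr
                exact hbx.trans (by gcongr)
            _ = ((2 * rk x + 1 : ℕ) : ℝ≥0∞) * gdist G w a b := by push_cast; ring
            _ ≤ _ := by gcongr
        · have hex : ∃ z ∈ A (rk x + 1), gdist G w b z ≤ gdist G w b x := by
            by_contra hcon
            push Not at hcon
            exact hb ⟨hbx', hcon⟩
          obtain ⟨z, hz, hzle⟩ := hex
          obtain ⟨y0, hy0, hmin⟩ :=
            Finset.exists_min_image (A (rk x + 1)) (fun z => gdist G w b z) ⟨z, hz⟩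
          obtain ⟨y, hy, hmax⟩ := Finset.exists_max_image
            ((A (rk x + 1)).filter fun z => gdist G w b z = gdist G w b y0) rk
            ⟨y0, Finset.mem_filter.2 ⟨hy0, rfl⟩⟩
          rw [Finset.mem_filter] at hy
          have hyr := hrkle y _ hy.1
          have hyx : gdist G w b y ≤ gdist G w b x := by
            rw [hy.2]; exact (hmin z hz).trans hzle
          have hyc : b ∈ cluster G w (A (rk y + 1)) y := by
            refine ⟨hyx.trans_lt hbx', fun t ht => ?_⟩
            have ht1 : t ∈ A (rk x + 1) := hanti (by omega) ht
            rw [hy.2]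
            refine lt_of_le_of_ne (hmin t ht1) fun heq => ?_
            have h1 := hmax t (Finset.mem_filter.2 ⟨ht1, heq.symm⟩)
            have h2 := hrkle t _ ht
            omega
          have hd' : gdist G w b y ≤ (rk y : ℝ≥0∞) * gdist G w b a := by
            rw [gdist_comm b a]
            calc gdist G w b y ≤ gdist G w a b + rk x * gdist G w a b :=
                  hyx.trans (hbx.trans (by gcongr))
              _ = ((rk x + 1 : ℕ) : ℝ≥0∞) * gdist G w a b := by push_cast; ring
              _ ≤ _ := by gcongr
          obtain ⟨t, ht, h1, h2, h3⟩ :=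
            ih b a y (hanti (Nat.zero_le _) hy.1) (by omega) hab.symm hyc hd'
          refine ⟨t, ht, h2, h1, ?_⟩
          rw [add_comm, gdist_comm a b]
          exact h3
    intro u hu v huv
    have hu' : u ∈ cluster G w (A (rk u + 1)) u := by
      refine ⟨by simp [gdist_self], fun z hz => ?_⟩
      rw [gdist_self]
      exact gdist_pos hw (fun h => hrk' u (h ▸ hz))
    obtain ⟨y, hy, h1, h2, h3⟩ := key K u v u hu (by omega) huv hu' (by simp [gdist_self])
    refine ⟨⟨y, hy⟩, by rw [hT2]; exact h1, by rw [hT2]; exact h2, ?_⟩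
    refine le_trans (add_le_add (hT3 _ _ h1) (hT3 _ _ h2)) ?_
    rw [gdist_comm _ u, gdist_comm _ v]
    exact h3
  · intro v
    have himg : (Subtype.val '' {s | v ∈ (T s).tree.verts}) ⊆
        ((Finset.range K).biUnion fun i =>
          (A i).filter fun x => ∀ z ∈ A (i + 1), gdist G w v x < gdist G w v z : Finset V) := by
      rintro _ ⟨s, hs, rfl⟩
      have hs' : v ∈ cluster G w (A (rk s.1 + 1)) s.1 := by rw [← hT2]; exact hs
      rw [Finset.mem_coe, Finset.mem_biUnion]
      exact ⟨rk s.1, Finset.mem_range.2 (hrkK _ s.2),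
        Finset.mem_filter.2 ⟨hrk _ s.2, hs'.2⟩⟩
    rw [← Set.ncard_image_of_injective _ Subtype.val_injective]
    refine (Set.ncard_le_ncard himg (Finset.finite_toSet _)).trans ?_
    rw [Set.ncard_coe_finset]
    exact Finset.card_biUnion_le

/-- The numerical estimate behind the bound on the overlap of the trees. -/
lemma numeric {L : ℝ} (hL : 1 ≤ L) (K : ℕ) (hK : K = ⌊L⌋₊) :
    ((K - 1 : ℕ) : ℝ) * (Real.exp (L / K) * (L + 1)) + Real.exp (L / K) ≤
      L * Real.exp 1 * (L + 1) := by
  have hK1 : 1 ≤ K := by rw [hK]; exact Nat.le_floor (by exact_mod_cast hL)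
  have hKL : (K : ℝ) ≤ L := by rw [hK]; exact Nat.floor_le (by linarith)
  have hLK : L < K + 1 := by rw [hK]; exact Nat.lt_floor_add_one _
  have hK1' : (1 : ℝ) ≤ K := by exact_mod_cast hK1
  rw [Nat.cast_sub hK1, Nat.cast_one]
  obtain ⟨θ, hθ⟩ : ∃ θ, L = K + θ := ⟨L - K, by ring⟩
  have hθ0 : 0 ≤ θ := by linarith
  have hθ1 : θ < 1 := by linarith
  set E := Real.exp (θ / K) with hE
  have hsplit : Real.exp (L / K) = Real.exp 1 * E := by
    rw [hE, ← Real.exp_add]; congr 1; rw [hθ]; field_simp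
  have hEpos : 0 < E := Real.exp_pos _
  have hE1 : E * (K - θ) ≤ K := by
    have h1 : 1 - θ / K ≤ Real.exp (-(θ / K)) := by
      have := Real.add_one_le_exp (-(θ / K)); linarith
    have h2 : E * (1 - θ / K) ≤ 1 := by
      calc E * (1 - θ / K) ≤ E * Real.exp (-(θ / K)) := by gcongr
        _ = 1 := by rw [hE, ← Real.exp_add]; simp
    calc E * (K - θ) = E * (1 - θ / K) * K := by field_simp
      _ ≤ 1 * K := by gcongr
      _ = K := one_mul _
  have hE2 : (K - 1) * E ≤ L - 1 := by
    have hpos : 0 < (K : ℝ) - θ := by linarith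
    rw [← mul_le_mul_iff_left₀ hpos]
    calc (K - 1) * E * (K - θ) = (K - 1) * (E * (K - θ)) := by ring
      _ ≤ (K - 1) * K := by
        apply mul_le_mul_of_nonneg_left hE1; linarith
      _ ≤ (L - 1) * (K - θ) := by rw [hθ]; nlinarith
  have hE3 : E ≤ L + 1 := by
    have h1 : E ≤ Real.exp 1 := by
      rw [hE, Real.exp_le_exp, div_le_one (by linarith)]; linarith
    by_cases h2 : 2 ≤ K
    · have : (2 : ℝ) ≤ K := by exact_mod_cast h2
      have := Real.exp_one_lt_d9
      linarith
    · have hKe : K = 1 := by omega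
      have : E = Real.exp θ := by rw [hE, hKe]; simp
      rw [this, hθ, hKe]
      have hb := Real.abs_exp_sub_one_sub_id_le (x := θ) (by rw [abs_of_nonneg hθ0]; exact hθ1.le)
      have := (abs_le.1 hb).2
      push_cast
      nlinarith
  rw [hsplit]
  have he : 0 < Real.exp 1 := Real.exp_pos _
  have : (K - 1) * E * (L + 1) + E ≤ L * (L + 1) := by
    nlinarith
  calc _ = Real.exp 1 * ((K - 1) * E * (L + 1) + E) := by ring
    _ ≤ Real.exp 1 * (L * (L + 1)) := by gcongr
    _ = _ := by ring

open Classical in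
lemma TreeCover.nonempty [Fintype V] (hn : 3 ≤ Fintype.card V)
    (hw : ∀ e ∈ G.edgeSet, 0 < w e) (S : Set V) : Nonempty (TreeCover G w S) := by
  have : Nonempty V := Fintype.card_pos_iff.1 (by omega)
  have hn' : (3 : ℝ) ≤ Fintype.card V := by exact_mod_cast hn
  have hnpos : (0 : ℝ) < Fintype.card V := by linarith
  obtain ⟨L, hL⟩ : ∃ L, L = Real.log (Fintype.card V) := ⟨_, rfl⟩
  have hL1 : 1 ≤ L := by
    rw [hL, Real.le_log_iff_exp_le hnpos]
    have := Real.exp_one_lt_d9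
    linarith
  obtain ⟨K, hK⟩ : ∃ K, K = ⌊L⌋₊ := ⟨_, rfl⟩
  have hK1 : 1 ≤ K := by rw [hK]; exact Nat.le_floor (by exact_mod_cast hL1)
  have hKL : (K : ℝ) ≤ L := by rw [hK]; exact Nat.floor_le (by linarith)
  have hKpos : (0 : ℝ) < K := by exact_mod_cast hK1
  obtain ⟨A, hA0, hA, hAK, hAb, hAlast⟩ := exists_seq (gdist G w) S.toFinset
    (Real.exp (L / K)) (Real.exp_pos _) K hK1
  obtain ⟨T, hT1, hT2, hT3⟩ := exists_cover_of_seq hw K A hA hAK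
  have hS : (A 0 : Set V) = S := by rw [hA0]; simp
  have hfin : ∀ v, ({s | v ∈ (T s).tree.verts}.ncard : ℝ) ≤ kParam V *
      (Fintype.card V : ℝ) ^ (1 / kParam V) * (Real.log (Fintype.card V) + 1) := by
    intro v
    have hpow : (Fintype.card V : ℝ) ^ (1 / kParam V) = Real.exp 1 := by
      rw [Real.rpow_def_of_pos hnpos, kParam, mul_one_div_cancel]
      rw [← hL]; linarith
    rw [hpow, kParam, ← hL]
    refine le_trans ?_ (numeric hL1 K hK)
    refine le_trans (Nat.cast_le.2 (hT3 v)) ?_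
    obtain ⟨m, rfl⟩ : ∃ m, K = m + 1 := ⟨K - 1, by omega⟩
    rw [Finset.sum_range_succ, Nat.cast_add]
    refine add_le_add ?_ ?_
    · rw [Nat.cast_sum]
      refine (Finset.sum_le_card_nsmul _ _ (Real.exp (L / (m + 1 : ℕ)) * (L + 1)) ?_).trans ?_
      · intro i hi
        rw [Finset.mem_range] at hi
        have := hAb i (by omega) v
        rw [← hL] at this
        exact this
      · simp [nsmul_eq_mul]
    · refine le_trans (Nat.cast_le.2 (Finset.card_filter_le _ _)) ?_
      refine le_trans hAlast ?_
      have h1 : (S.toFinset.card : ℝ) ≤ Fintype.card V := by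
        exact_mod_cast Finset.card_le_univ _
      rw [div_le_iff₀ (by positivity)]
      refine h1.trans (le_of_eq ?_)
      rw [Nat.add_sub_cancel, ← pow_succ', ← Real.exp_nat_mul, mul_div_cancel₀ _ hKpos.ne', hL,
        Real.exp_log hnpos]
  have hst : ∀ u ∈ A 0, ∀ v, G.Reachable u v → ∃ s, u ∈ (T s).tree.verts ∧
      v ∈ (T s).tree.verts ∧ (T s).depth w u + (T s).depth w v ≤
        ENNReal.ofReal (2 * kParam V - 1) * gdist G w u v := by
    intro u hu v huv
    obtain ⟨s, h1, h2, h3⟩ := hT2 u hu v huv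
    refine ⟨s, h1, h2, h3.trans ?_⟩
    gcongr
    rw [← ENNReal.ofReal_natCast]
    apply ENNReal.ofReal_le_ofReal
    rw [kParam, ← hL]
    push_cast [Nat.cast_sub hK1]
    linarith
  subst hS
  exact ⟨⟨T, hT1, fun u hu => hst u hu, hfin⟩⟩

/-- Covers and shortest paths as required exist for every input graph. -/
theorem Choices.nonempty [Fintype V] (hn : 3 ≤ Fintype.card V)
    (hw : ∀ e ∈ G.edgeSet, 0 < w e) : Nonempty (Choices G w) := by
  classical
  have hw' : ∀ R : Set V, ∀ e ∈ (delVerts G R).edgeSet, 0 < w e := by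
    intro R e
    induction e with
    | _ a b => exact fun h => hw _ (G.mem_edgeSet.2 h.1)
  exact ⟨{
    cover := fun R S => (TreeCover.nonempty hn (hw' R) (S \ R)).some
    path := fun A x y => if h : (delVerts G A).Reachable x y then
      some (exists_shortest (w := w) h).choose else none
    path_none := by intro A x y; simp
    path_shortest := by
      intro A x y P hP
      by_cases h : (delVerts G A).Reachable x y
      · rw [dif_pos h] at hP
        obtain rfl := Option.some.inj hP
        exact (exists_shortest (w := w) h).choose_spec
      · rw [dif_neg h] at hP
        cases hP }⟩
end Cover2

end VSDO

/-! The lower bound and the bounded depth are soft. `DecTree` returns the length of a path free of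
failures, hence of a path in `G - D` (or `⊤`). Each descent puts the picked failure `f` into
`avoid`, because `f` lies in its own segment and in `U_{l(f)}`; so at most `|D| ≤ d` descents occur.

For the upper bound, suppose the answer for `(x, y)` exceeds the length of a walk `P` of `G - D`.
Then some descent removed a vertex `z` of `P`: `z` shares a segment of `P_α` with the picked `f`,
and `l(z) ≥ l(f)`. The piece of `P_α` from `z` to `f` is at most `ε₂` times the distance from `z` to
either end, and by the choice of `f` its failures have level at most `l(z)`. Cut it at its first
failure `f₁` and let `g` be a vertex of highest level `j` before `f₁`. From `g` to `f₁` no vertex is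
in `U_{j+1}`, so a tree of the cover of `G - U_{j+1}` with sources `U_j \ U_{j+1}` joins `g` to `f₁`
with stretch `2k - 1`. Just before the first failure on that tree route sits a vertex `q` of `H`,
and `(2k - 1) ε₂ = ε₁`. So `z` is a detour in the sense of `IsDetour`: `q` is within `ε₁` times the
distance from `z` to either end of `P` (`exists_mem_VH_near`, `decTreeLoop_spec`).

It remains to walk in `H` (`exists_hop`). On a shortest `x`–`y` path of `G - D` take the vertex `z`
closest to `x` that has a vertex of `H` within `ε₁ |P[x, z]|`, and let `q` be the vertex of `H`
nearest to `z`. The walk from `x` through `z` to `q` has no detour, since one would contradict one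
of the two minimal choices; hence the edge from `x` to `q` costs at most `(1 + ε₁) |P[x, z]|`. The
remaining distance to `y` has strictly dropped, and induction gives stretch `(1 + ε₁)/(1 - ε₁) = 1 +
ε` (`auxDist_le_of_hop`). -/

namespace VSDO

/-! ### Lengths of walks and walks in `G - R` -/

section Walks
variable {V : Type*} {G H : SimpleGraph V} {w : Sym2 V → ℝ≥0}

lemma len_append {a b c : V} (P : G.Walk a b) (Q : G.Walk b c) :
    len w (P.append Q) = len w P + len w Q := by
  simp [len]

lemma len_reverse {a b : V} (P : G.Walk a b) : len w P.reverse = len w P := by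
  simp [len]

lemma len_cons {a b c : V} (h : G.Adj a b) (P : G.Walk b c) :
    len w (P.cons h) = w s(a, b) + len w P := by
  simp [len]

lemma gdist_le_len {a b : V} (P : G.Walk a b) : gdist G w a b ≤ len w P := iInf_le _ P

lemma len_pos (hw : ∀ e ∈ G.edgeSet, 0 < w e) {a b : V} (P : G.Walk a b) (hab : a ≠ b) :
    0 < len w P := by
  cases P with
  | nil => exact absurd rfl hab
  | cons h P =>
    rw [len_cons]
    exact lt_of_lt_of_le (hw _ h) le_self_add

lemma delVerts_le (G : SimpleGraph V) (R : Set V) : delVerts G R ≤ G := fun _ _ h => h.1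

/-- A walk that starts outside `R` stays outside `R` in `G - R`. -/
lemma notMem_of_mem_support_delVerts {R : Set V} {a b x : V} (P : (delVerts G R).Walk a b)
    (ha : a ∉ R) (hx : x ∈ P.support) : x ∉ R := by
  induction P with
  | nil => simp_all
  | cons h P ih =>
    rw [SimpleGraph.Walk.support_cons, List.mem_cons] at hx
    rcases hx with rfl | hx
    · exact ha
    · exact ih h.2.2 hx

/-- A walk in a subgraph of `G` that avoids `R` is a walk in `G - R`. -/
lemma exists_walk_delVerts (hH : H ≤ G) {R : Set V} {a b : V} (P : H.Walk a b)
    (hP : ∀ x ∈ P.support, x ∉ R) :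
    ∃ Q : (delVerts G R).Walk a b, Q.support = P.support ∧ len w Q = len w P := by
  have h : ∀ e ∈ P.edges, e ∈ (delVerts G R).edgeSet := by
    intro e
    induction e with
    | _ x y =>
      intro he
      exact ⟨hH (P.adj_of_mem_edges he), hP _ (P.fst_mem_support_of_mem_edges he),
        hP _ (P.snd_mem_support_of_mem_edges he)⟩
  exact ⟨P.transfer _ h, by simp, by simp [len]⟩

lemma gdist_delVerts_le_len (hH : H ≤ G) {R : Set V} {a b : V} (P : H.Walk a b)
    (hP : ∀ x ∈ P.support, x ∉ R) : gdist (delVerts G R) w a b ≤ len w P := by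
  obtain ⟨Q, -, hQ⟩ := exists_walk_delVerts (w := w) hH P hP
  rw [← hQ]
  exact gdist_le_len Q

/-- Splitting a walk at the first vertex that belongs to `D`. -/
lemma exists_first_mem {D : Set V} {a b : V} (P : G.Walk a b) (ha : a ∉ D) {f : V}
    (hf : f ∈ D) (hfP : f ∈ P.support) :
    ∃ (q f' : V) (A : G.Walk a q) (h : G.Adj q f') (B : G.Walk f' b),
      P = A.append (B.cons h) ∧ (∀ x ∈ A.support, x ∉ D) ∧ f' ∈ D := by
  induction P with
  | nil =>
    rw [SimpleGraph.Walk.support_nil, List.mem_singleton] at hfP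
    exact absurd hf (hfP ▸ ha)
  | @cons a c b h P ih =>
    by_cases hc : c ∈ D
    · exact ⟨a, c, .nil, h, P, by simp, by simpa using ha, hc⟩
    · rw [SimpleGraph.Walk.support_cons, List.mem_cons] at hfP
      obtain ⟨q, f', A, h', B, rfl, hA, hf'⟩ :=
        ih hc (hfP.resolve_left fun e => ha (e ▸ hf))
      refine ⟨q, f', A.cons h, h', B, by simp, ?_, hf'⟩
      intro x hx
      rw [SimpleGraph.Walk.support_cons, List.mem_cons] at hx
      rcases hx with rfl | hx
      · exact ha
      · exact hA x hx

end Walks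

/-! ### From a source to a failed vertex along a cover tree -/

section Trees
variable {V : Type*} {G H : SimpleGraph V} {w : Sym2 V → ℝ≥0}

lemma RootedTree.reachable (T : RootedTree G) {x y : V} (hx : x ∈ T.tree.verts)
    (hy : y ∈ T.tree.verts) : T.tree.spanningCoe.Reachable x y :=
  (T.isTree.connected ⟨x, hx⟩ ⟨y, hy⟩).map
    (⟨Subtype.val, fun h => h⟩ : T.tree.coe →g T.tree.spanningCoe)

lemma RootedTree.exists_path_root [Finite V] (T : RootedTree G) (w : Sym2 V → ℝ≥0) {x : V}
    (hx : x ∈ T.tree.verts) :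
    ∃ P : T.tree.spanningCoe.Walk x T.root, P.IsPath ∧ T.depth w x = len w P := by
  obtain ⟨P, hP⟩ := exists_shortest (w := w) (T.reachable hx T.root_mem)
  refine ⟨P, hP.1, ?_⟩
  rw [RootedTree.depth, gdist_comm, hP.gdist_eq]

/-- On the tree path from a source `g` to a failed vertex, the last vertex before the first
failure `f'` is in `N_T(f')`. -/
lemma RootedTree.exists_mem_nbrs [Finite V] (hH : H ≤ G) (T : RootedTree H) {S D : Set V}
    (hr : T.root ∈ S) {g f : V} (hgS : g ∈ S) (hgD : g ∉ D) (hfD : f ∈ D)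
    (hg : g ∈ T.tree.verts) (hf : f ∈ T.tree.verts) :
    ∃ f' ∈ D, f' ∈ T.tree.verts ∧ ∃ q ∈ T.nbrs S f', q ∉ D ∧
      gdist (delVerts G D) w g q ≤ T.depth w g + T.depth w f := by
  have hle : T.tree.spanningCoe ≤ G := fun _ _ h => hH (T.tree.adj_sub h)
  obtain ⟨A, hA, hdA⟩ := T.exists_path_root w hg
  obtain ⟨B, hB, hdB⟩ := T.exists_path_root w hf
  -- The route goes up from `g` to the root and down to `f`. If the ascent meets a failure, `q` is a
  -- child of `f'`; otherwise it is the parent.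
  by_cases hAD : ∃ x ∈ A.support, x ∈ D
  · obtain ⟨x, hxA, hxD⟩ := hAD
    obtain ⟨q, f', A₁, h, A₂, rfl, hA₁, hf'⟩ := exists_first_mem A hgD hxD hxA
    refine ⟨f', hf', T.tree.edge_vert h.symm, q, Or.inr ⟨⟨h, A₂, hA.of_append_right⟩, ?_⟩,
      hA₁ _ A₁.end_mem_support, ?_⟩
    -- The child `q` is a trunk vertex because the ascent joins two sources, `g` and the root.
    · exact ⟨g, hgS, T.root, hr, hg, T.root_mem, _, hA, by simp⟩
    · refine (gdist_delVerts_le_len hle A₁ hA₁).trans (le_trans ?_ le_self_add)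
      rw [hdA, len_append, ENNReal.coe_le_coe]
      exact le_self_add
  · push Not at hAD
    have hB' := hB.reverse
    rw [← len_reverse] at hdB
    obtain ⟨q, f', B₁, h, B₂, hBe, hB₁, hf'⟩ := exists_first_mem B.reverse
      (hAD _ A.end_mem_support) hfD (by simp)
    rw [hBe] at hB' hdB
    refine ⟨f', hf', T.tree.edge_vert h.symm, q, Or.inl ⟨h.symm, B₁.reverse, ?_⟩,
      hB₁ _ B₁.end_mem_support, ?_⟩
    · rw [← SimpleGraph.Walk.concat_append] at hB'
      have := hB'.of_append_left.reverse
      rwa [SimpleGraph.Walk.reverse_concat] at this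
    -- Ascent and descent may overlap, so this need not be a path; a walk suffices to bound the
    -- distance.
    · refine (gdist_delVerts_le_len hle (A.append B₁) ?_).trans ?_
      · intro x hx
        rw [SimpleGraph.Walk.mem_support_append_iff] at hx
        exact hx.elim (hAD x) (hB₁ x)
      · rw [hdA, hdB, len_append, len_append, ENNReal.coe_add]
        gcongr
        exact le_self_add

end Trees

/-! ### Segments of a path and prefix lengths -/

section SegmentLengths
variable {V : Type*} [DecidableEq V] {G : SimpleGraph V} {w : Sym2 V → ℝ≥0}

lemma lenTo_eq {x y t : V} (P : G.Walk x y) (ht : t ∈ P.support) :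
    lenTo w P t = len w (P.takeUntil t ht) := dif_pos ht

lemma lenFrom_eq {x y t : V} (P : G.Walk x y) (ht : t ∈ P.support) :
    lenFrom w P t = len w (P.dropUntil t ht) := dif_pos ht

lemma lenTo_add_lenFrom {x y t : V} (P : G.Walk x y) (ht : t ∈ P.support) :
    lenTo w P t + lenFrom w P t = len w P := by
  rw [lenTo_eq P ht, lenFrom_eq P ht, ← NNReal.coe_add, ← len_append, P.take_spec ht]

lemma lenTo_pos (hw : ∀ e ∈ G.edgeSet, 0 < w e) {x y t : V} (P : G.Walk x y)
    (ht : t ∈ P.support) (hx : t ≠ x) : 0 < lenTo w P t := by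
  rw [lenTo_eq P ht]
  exact_mod_cast len_pos hw _ hx.symm

lemma lenFrom_pos (hw : ∀ e ∈ G.edgeSet, 0 < w e) {x y t : V} (P : G.Walk x y)
    (ht : t ∈ P.support) (hy : t ≠ y) : 0 < lenFrom w P t := by
  rw [lenFrom_eq P ht]
  exact_mod_cast len_pos hw _ hy

/-- First occurrences along a walk are linearly ordered. This allows assuming that `s` comes before
`t`. -/
lemma mem_support_takeUntil_or {x y s t : V} (P : G.Walk x y) (hs : s ∈ P.support)
    (ht : t ∈ P.support) :
    s ∈ (P.takeUntil t ht).support ∨ t ∈ (P.takeUntil s hs).support := by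
  induction P with
  | nil =>
    simp only [SimpleGraph.Walk.support_nil, List.mem_singleton] at hs ht
    subst hs ht
    exact Or.inl (SimpleGraph.Walk.start_mem_support _)
  | @cons a b c h P ih =>
    by_cases e1 : a = s
    · subst e1; exact Or.inl (SimpleGraph.Walk.start_mem_support _)
    by_cases e2 : a = t
    · subst e2; exact Or.inr (SimpleGraph.Walk.start_mem_support _)
    have hs' := (List.mem_cons.1 hs).resolve_left (Ne.symm e1)
    have ht' := (List.mem_cons.1 ht).resolve_left (Ne.symm e2)
    rw [SimpleGraph.Walk.takeUntil_cons hs' e1, SimpleGraph.Walk.takeUntil_cons ht' e2]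
    exact (ih hs' ht').imp (List.mem_cons_of_mem _) (List.mem_cons_of_mem _)

/-- The part of `P` between two of its vertices. -/
lemma exists_walk_between {x y s t : V} (P : G.Walk x y) (hs : s ∈ P.support)
    (ht : t ∈ P.support) :
    ∃ Q : G.Walk s t, (∀ z ∈ Q.support, z ∈ P.support) ∧
      (len w Q : ℝ) = |lenTo w P s - lenTo w P t| := by
  wlog h : s ∈ (P.takeUntil t ht).support generalizing s t
  · obtain ⟨Q, hQ, hl⟩ := this ht hs ((mem_support_takeUntil_or P hs ht).resolve_left h)
    exact ⟨Q.reverse, by simpa using hQ, by rw [len_reverse, hl, abs_sub_comm]⟩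
  · refine ⟨(P.takeUntil t ht).dropUntil s h, fun z hz => ?_, ?_⟩
    · exact P.support_takeUntil_subset_support ht
        ((P.takeUntil t ht).support_dropUntil_subset_support h hz)
    · have h1 := (P.takeUntil t ht).take_spec h
      have h2 := len_append (w := w) ((P.takeUntil t ht).takeUntil s h)
        ((P.takeUntil t ht).dropUntil s h)
      rw [h1, SimpleGraph.Walk.takeUntil_takeUntil] at h2
      rw [lenTo_eq P hs, lenTo_eq P ht, h2, NNReal.coe_add, abs_sub_comm, add_sub_cancel_left,
        NNReal.abs_eq]

/-- The logarithms differ by less than `1`, so `a / b` lies between `1 / (1 + e)` and `1 + e`; and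
`1 / (1 + e) ≥ 1 - e`. -/
lemma abs_sub_le_of_floor_logb_eq {e a b : ℝ} (he : 0 < e) (ha : 0 < a) (hb : 0 < b)
    (h : ⌊Real.logb (1 + e) a⌋ = ⌊Real.logb (1 + e) b⌋) : |b - a| ≤ e * b := by
  have h1 : (1 : ℝ) < 1 + e := by linarith
  have key : ∀ {a b : ℝ}, 0 < a → 0 < b → ⌊Real.logb (1 + e) a⌋ = ⌊Real.logb (1 + e) b⌋ →
      a < (1 + e) * b := by
    intro a b ha hb h
    have h2 := Int.abs_sub_lt_one_of_floor_eq_floor h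
    rw [← Real.logb_div ha.ne' hb.ne', abs_lt] at h2
    rw [← div_lt_iff₀ hb]
    have := (Real.logb_lt_iff_lt_rpow h1 (div_pos ha hb)).1 h2.2
    simpa using this
  have h3 := key ha hb h
  have h4 := key hb ha h.symm
  rw [abs_le]
  constructor <;> nlinarith

/-- Two vertices of the same segment are close to each other, relative to the distance from
either end of the path. -/
lemma exists_walk_of_mem_seg (hw : ∀ e ∈ G.edgeSet, 0 < w e) {e : ℝ} (he : 0 < e) {x y f z : V}
    (P : G.Walk x y) (hf : f ∈ P.support) (hfx : f ≠ x) (hfy : f ≠ y) (hz : z ∈ seg w e f P) :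
    ∃ Q : G.Walk z f, (∀ t ∈ Q.support, t ∈ P.support) ∧
      (len w Q : ℝ) ≤ e * lenTo w P z ∧ (len w Q : ℝ) ≤ e * lenFrom w P z := by
  obtain ⟨hzP, hzx, hzy, hs⟩ := hz
  obtain ⟨Q, hQ, hl⟩ := exists_walk_between (w := w) P hzP hf
  have hfs := lenTo_add_lenFrom (w := w) P hf
  have hzs := lenTo_add_lenFrom (w := w) P hzP
  refine ⟨Q, hQ, ?_⟩
  rw [hl]
  rcases hs with ⟨h1, h2, h3⟩ | ⟨h1, h2, h3⟩
  · have h4 := abs_sub_le_of_floor_logb_eq he (lenTo_pos hw P hf hfx) (lenTo_pos hw P hzP hzx) h3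
    exact ⟨h4, h4.trans (by gcongr; linarith)⟩
  · have h4 := abs_sub_le_of_floor_logb_eq he (lenFrom_pos hw P hf hfy)
      (lenFrom_pos hw P hzP hzy) h3
    rw [show lenFrom w P z - lenFrom w P f = -(lenTo w P z - lenTo w P f) by linarith,
      abs_neg] at h4
    exact ⟨h4.trans (by gcongr; linarith), h4⟩

/-- The weak inequality for the first half and the strict one for the second leave no inner vertex
out. Hence a descent always removes the picked failure. -/
lemma mem_seg_self {e : ℝ} {x y f : V} (P : G.Walk x y) (hf : f ∈ P.support) (hfx : f ≠ x)
    (hfy : f ≠ y) : f ∈ seg w e f P := by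
  have hfs := lenTo_add_lenFrom (w := w) P hf
  refine ⟨hf, hfx, hfy, ?_⟩
  rcases le_or_gt (lenTo w P f) (len w P / 2) with h | h
  · exact Or.inl ⟨h, h, rfl⟩
  · exact Or.inr ⟨by linarith, by linarith, rfl⟩

/-- A prefix of a shortest walk is shortest. -/
lemma lenTo_le_of_shortest {x y z : V} {P : G.Walk x y} (hP : IsShortestPath w P)
    (hz : z ∈ P.support) (A : G.Walk x z) : lenTo w P z ≤ len w A := by
  have h := hP.2 (A.append (P.dropUntil z hz))
  have h2 := lenTo_add_lenFrom (w := w) P hz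
  rw [len_append, ← NNReal.coe_le_coe, NNReal.coe_add, ← lenFrom_eq P hz] at h
  linarith

/-- A suffix of a shortest walk is shortest. -/
lemma lenFrom_le_of_shortest {x y z : V} {P : G.Walk x y} (hP : IsShortestPath w P)
    (hz : z ∈ P.support) (B : G.Walk z y) : lenFrom w P z ≤ len w B := by
  have h := hP.2 ((P.takeUntil z hz).append B)
  have h2 := lenTo_add_lenFrom (w := w) P hz
  rw [len_append, ← NNReal.coe_le_coe, NNReal.coe_add, ← lenTo_eq P hz] at h
  linarith

end SegmentLengths

/-- Since `e < 3 ≤ n`, `k = ln n > 1`. Thus `eps2` is positive, and a piece of a walk used without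
stretch can be charged at rate `2k - 1`. -/
lemma one_lt_two_mul_kParam_sub_one {V : Type*} [Fintype V] (hn : 3 ≤ Fintype.card V) :
    1 < 2 * kParam V - 1 := by
  have hn' : (3 : ℝ) ≤ Fintype.card V := by exact_mod_cast hn
  have : 1 < kParam V := by
    rw [kParam, Real.lt_log_iff_exp_lt (by linarith)]
    have := Real.exp_one_lt_d9
    linarith
  linarith

/-- `z` is an inner vertex of the walk `P` in `G - D`, and in `G - D` the vertex `q` is within
`e` times the distance from `z` to either end of `P`. -/
def IsDetour {V : Type*} (w : Sym2 V → ℝ≥0) (e : ℝ) {G : SimpleGraph V} {x y : V} (P : G.Walk x y)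
    (z q : V) : Prop :=
  z ∈ P.support ∧ z ≠ x ∧ z ≠ y ∧ ∀ (A : G.Walk x z) (B : G.Walk z y), P = A.append B →
    gdist G w z q ≤ ENNReal.ofReal (e * len w A) ∧ gdist G w z q ≤ ENNReal.ofReal (e * len w B)

namespace Choices

variable {V : Type*} [Fintype V] {G : SimpleGraph V} {w : Sym2 V → ℝ≥0} (O : Choices G w)
  (d : ℕ) (c : ℝ) (D : Set V)

/-! ### Levels are well defined -/

section Levels

lemma pathFrom_eq_cons (m : ℕ) (U : Set V) : ∃ l, O.pathFrom d c D m U = U :: l := by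
  cases m with
  | zero => exact ⟨[], rfl⟩
  | succ m =>
    rw [pathFrom]
    split_ifs
    exacts [⟨_, rfl⟩, ⟨_, rfl⟩, ⟨_, rfl⟩]

lemma U_one : O.U d c D 1 = Set.univ := by
  obtain ⟨l, hl⟩ := O.pathFrom_eq_cons d c D ⌊1 / c * Real.logb d (Fintype.card V)⌋₊ Set.univ
  rw [U, hpath, hl]
  rfl

variable {O d c D}

/-- Beyond `p` the lookup returns the default `∅`. So the indices in the definition of `level` are
bounded, and with `U_1 = V` the supremum is attained. -/
lemma le_length_of_mem_U {x : V} {i : ℕ} (h : x ∈ O.U d c D i) :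
    i ≤ (O.hpath d c D).length := by
  by_contra hi
  rw [U, List.getD_eq_default] at h
  · exact h
  · rw [List.length_cons]; omega

lemma le_level {x : V} {i : ℕ} (h : x ∈ O.U d c D i) : i ≤ O.level d c D x :=
  le_csSup ⟨_, fun _ hj => le_length_of_mem_U hj⟩ h

lemma one_le_level (x : V) : 1 ≤ O.level d c D x :=
  le_level (by rw [U_one]; trivial)

lemma mem_U_level (x : V) : x ∈ O.U d c D (O.level d c D x) :=
  Nat.sSup_mem (s := {i | x ∈ O.U d c D i}) ⟨1, by rw [Set.mem_ofPred_eq, U_one]; trivial⟩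
    ⟨_, fun _ hj => le_length_of_mem_U hj⟩

end Levels

/-! ### A vertex of `H` close to a removed vertex -/

variable {O d c D}

/-- If `z` is joined to a failed vertex by a walk all of whose failed vertices have at most the
level of `z`, then there is a vertex of `H` close to `z` in `G - D`. -/
lemma exists_mem_VH_near (hn : 3 ≤ Fintype.card V) (u v : V) {H : SimpleGraph V} (hH : H ≤ G)
    {z f : V} (Q : H.Walk z f) (hz : z ∉ D) (hf : f ∈ D)
    (hlev : ∀ t ∈ Q.support, t ∈ D → O.level d c D t ≤ O.level d c D z) :
    ∃ q ∈ O.VH d c D u v,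
      gdist (delVerts G D) w z q ≤ ENNReal.ofReal ((2 * kParam V - 1) * len w Q) := by
  classical
  have hk := one_lt_two_mul_kParam_sub_one hn
  obtain ⟨p, f₁, A, h, B, rfl, hA, hf₁⟩ := exists_first_mem Q hz hf Q.end_mem_support
  -- With `g` of highest level `j` before the first failure `f₁`, the stretch from `g` to `f₁`
  -- avoids `U_{j+1}`, while `g` is a source of the cover of `G - U_{j+1}`.
  obtain ⟨g, hgA, hg⟩ := Finset.exists_max_image A.support.toFinset (O.level d c D)
    ⟨z, by simp⟩
  simp only [List.mem_toFinset] at hgA hg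
  obtain ⟨A₁, A₂, rfl⟩ := SimpleGraph.Walk.mem_support_iff_exists_append.1 hgA
  set j := O.level d c D g with hj
  have hmax : ∀ t ∈ (A₂.concat h).support, t ∉ O.U d c D (j + 1) := by
    intro t ht htU
    have h1 := le_level htU
    rw [SimpleGraph.Walk.support_concat, List.mem_append,
      List.mem_singleton] at ht
    rcases ht with ht | rfl
    · have := hg t (by rw [SimpleGraph.Walk.mem_support_append_iff]; exact Or.inr ht)
      omega
    -- The endpoint `f₁` is covered by `l(f₁) ≤ l(z) ≤ l(g) = j`.
    · have h2 := hlev t (by simp) hf₁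
      have h3 := hg z (SimpleGraph.Walk.start_mem_support _)
      omega
  obtain ⟨Q', -, hQ'⟩ := exists_walk_delVerts (w := w) hH (A₂.concat h) hmax
  have hgS : g ∈ O.U d c D j \ O.U d c D (j + 1) :=
    ⟨mem_U_level g, hmax g (SimpleGraph.Walk.start_mem_support _)⟩
  obtain ⟨s, hgT, hfT, hst⟩ :=
    (O.cover (O.U d c D (j + 1)) (O.U d c D j)).stretch g hgS f₁ ⟨Q'⟩
  have hr : ((O.cover (O.U d c D (j + 1)) (O.U d c D j)).T s).root ∈
      O.U d c D j \ O.U d c D (j + 1) := by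
    rw [TreeCover.root_eq]; exact s.2
  obtain ⟨f', hf', hf'T, q, hq, hqD, hdist⟩ := RootedTree.exists_mem_nbrs (w := w)
    (delVerts_le G _) _ hr hgS (hA g hgA) hf₁ hgT hfT
  refine ⟨q, ⟨Or.inr (Set.mem_iUnion₂.2 ⟨f', hf', j, one_le_level g,
    le_length_of_mem_U (mem_U_level g), s, hf'T, hq⟩), hqD⟩, ?_⟩
  have h1 : gdist (delVerts G D) w z g ≤ len w A₁ := gdist_delVerts_le_len hH A₁
    fun x hx => hA x (by rw [SimpleGraph.Walk.mem_support_append_iff]; exact Or.inl hx)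
  have h2 : gdist (delVerts G D) w g q ≤
      ENNReal.ofReal (2 * kParam V - 1) * len w (A₂.concat h) := by
    refine hdist.trans (hst.trans ?_)
    gcongr
    rw [← hQ']
    exact gdist_le_len Q'
  have h3 : ((A₁.append A₂).append (B.cons h)) = (A₁.append (A₂.concat h)).append B := by
    rw [← SimpleGraph.Walk.append_assoc, ← SimpleGraph.Walk.append_assoc,
      SimpleGraph.Walk.concat_append]
  rw [ENNReal.ofReal_mul (by linarith), ENNReal.ofReal_coe_nnreal, h3, len_append, len_append]
  -- Only the stretch from `g` to `f₁` pays the factor `2k - 1`; the piece from `z` to `g` is used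
  -- as it is.
  calc gdist (delVerts G D) w z q
      ≤ len w A₁ + ENNReal.ofReal (2 * kParam V - 1) * len w (A₂.concat h) :=
        (gdist_triangle z g q).trans (add_le_add h1 h2)
    _ ≤ ENNReal.ofReal (2 * kParam V - 1) * len w A₁ +
          ENNReal.ofReal (2 * kParam V - 1) * len w (A₂.concat h) := by
        gcongr
        refine le_mul_of_one_le_left zero_le ?_
        rw [← ENNReal.ofReal_one]
        exact ENNReal.ofReal_le_ofReal hk.le
    _ ≤ _ := by
        rw [← mul_add, ← ENNReal.coe_add]
        exact mul_le_mul' le_rfl (ENNReal.coe_le_coe.2 le_self_add)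

/-! ### The loop of `DecTree`: termination and its two estimates -/

section DecisionTree

lemma hit_of_path_eq_some {x y : V} {α : Node V}
    {P : (delVerts G (O.avoid d c D α)).Walk x y}
    (h : O.path (O.avoid d c D α) x y = some P) :
    O.hit d c D x y α = {f | f ∈ D ∧ f ∈ P.support} := by
  rw [hit, h]

lemma storedLen_of_path_eq_some {x y : V} {α : Node V}
    {P : (delVerts G (O.avoid d c D α)).Walk x y}
    (h : O.path (O.avoid d c D α) x y = some P) : O.storedLen d c D x y α = len w P := by
  rw [storedLen, h]

variable [DecidableEq V]

lemma avoid_descend {ε : ℝ} {x y f : V} {α : Node V}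
    {P : (delVerts G (O.avoid d c D α)).Walk x y}
    (h : O.path (O.avoid d c D α) x y = some P) :
    O.avoid d c D (O.descend d c ε D x y α f) =
      O.avoid d c D α ∪ (seg w (eps2 V ε) f P ∩ O.U d c D (O.level d c D f)) := by
  rw [descend, h]
  rfl

/-- The loop of `DecTree` at a node `α` with enough layers below it. -/
lemma decTreeLoop_spec (hn : 3 ≤ Fintype.card V) (hw : ∀ e ∈ G.edgeSet, 0 < w e) {ε : ℝ}
    (hε : 0 < ε) {pick : V → V → Node V → V} (hpick : O.IsPick d c D pick) (u v : V) {x y : V}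
    (hxD : x ∉ D) (hyD : y ∉ D) (m : ℕ) (α : Node V)
    (hm : (D \ O.avoid d c D α).ncard ≤ m) (hx : x ∉ O.avoid d c D α)
    (hy : y ∉ O.avoid d c D α) :
    ∃ r, O.decTreeLoop d c ε D pick x y m α = some r ∧ gdist (delVerts G D) w x y ≤ r ∧
      ∀ P : (delVerts G D).Walk x y, (∀ t ∈ P.support, t ∉ O.avoid d c D α) →
        r ≤ len w P ∨ ∃ z, ∃ q ∈ O.VH d c D u v, IsDetour w (ε / (2 + ε)) P z q := by
  have hk := one_lt_two_mul_kParam_sub_one hn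
  have he2 : 0 < eps2 V ε := by
    rw [eps2]
    have : 0 < 2 * kParam V - 1 := by linarith
    positivity
  by_cases hhit : O.hit d c D x y α = ∅
  · refine ⟨O.storedLen d c D x y α, by cases m <;> simp [decTreeLoop, hhit], ?_⟩
    rcases hP : O.path (O.avoid d c D α) x y with _ | P
    · have hs : O.storedLen d c D x y α = ⊤ := by rw [storedLen, hP]
      refine ⟨hs ▸ le_top, fun P' hP' => ?_⟩
      -- A walk that misses `avoid(α)` would connect `x` and `y` in `G - avoid(α)`, so the answer
      -- `⊤` leaves no such walk to compare with.
      obtain ⟨Q, -, -⟩ := exists_walk_delVerts (w := w) (delVerts_le G D) P' hP'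
      exact absurd ⟨Q⟩ ((O.path_none _ _ _).1 hP)
    · rw [storedLen_of_path_eq_some hP]
      rw [hit_of_path_eq_some hP] at hhit
      refine ⟨gdist_delVerts_le_len (delVerts_le G _) P fun t ht htD => ?_, fun P' hP' => ?_⟩
      · exact (Set.eq_empty_iff_forall_notMem.1 hhit) t ⟨htD, ht⟩
      · obtain ⟨Q, -, hQ⟩ := exists_walk_delVerts (w := w) (delVerts_le G D) P' hP'
        refine Or.inl ?_
        rw [← hQ, ENNReal.coe_le_coe]
        exact (O.path_shortest _ _ _ P hP).2 Q
  · obtain ⟨hf, hfmax⟩ := hpick x y α (Set.nonempty_iff_ne_empty.2 hhit)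
    set f := pick x y α with hfdef
    rcases hP : O.path (O.avoid d c D α) x y with _ | P
    · rw [hit, hP] at hf
      exact absurd hf (Set.notMem_empty _)
    rw [hit_of_path_eq_some hP] at hf hfmax
    obtain ⟨hfD, hfP⟩ := hf
    have hfx : f ≠ x := fun h => hxD (h ▸ hfD)
    have hfy : f ≠ y := fun h => hyD (h ▸ hfD)
    have hfα : f ∉ O.avoid d c D α := notMem_of_mem_support_delVerts P hx hfP
    have hav := avoid_descend (ε := ε) (f := f) hP
    -- The number of failures not yet avoided bounds the layers still needed; it drops because `f`
    -- was on `P_α` and is now avoided.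
    have hlt : (D \ O.avoid d c D (O.descend d c ε D x y α f)).ncard <
        (D \ O.avoid d c D α).ncard := by
      refine Set.ncard_lt_ncard ⟨?_, fun hsub => ?_⟩ (Set.toFinite _)
      · rw [hav]
        exact Set.sdiff_subset_sdiff_right Set.subset_union_left
      · refine (hsub ⟨hfD, hfα⟩).2 ?_
        rw [hav]
        exact Or.inr ⟨mem_seg_self P hfP hfx hfy, mem_U_level f⟩
    obtain ⟨m, rfl⟩ : ∃ m', m = m' + 1 := ⟨m - 1, by omega⟩
    have hx' : x ∉ O.avoid d c D (O.descend d c ε D x y α f) := by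
      rw [hav]
      rintro (h | h)
      exacts [hx h, h.1.2.1 rfl]
    have hy' : y ∉ O.avoid d c D (O.descend d c ε D x y α f) := by
      rw [hav]
      rintro (h | h)
      exacts [hy h, h.1.2.2.1 rfl]
    obtain ⟨r, hr, hle, hr'⟩ :=
      decTreeLoop_spec hn hw hε hpick u v hxD hyD m _ (by omega) hx' hy'
    refine ⟨r, by rw [decTreeLoop, if_neg hhit]; exact hr, hle, fun P' hP' => ?_⟩
    -- Either the walk survives this descent and the recursive call handles it, or this descent
    -- removes one of its vertices `z`, which becomes the detour.
    by_cases hdis : ∀ t ∈ P'.support, t ∉ O.avoid d c D (O.descend d c ε D x y α f)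
    · exact hr' P' hdis
    refine Or.inr ?_
    push Not at hdis
    obtain ⟨z, hzP', hz⟩ := hdis
    rw [hav] at hz
    obtain ⟨hzseg, hzU⟩ := hz.resolve_left (hP' z hzP')
    have hzD : z ∉ D := notMem_of_mem_support_delVerts P' hxD hzP'
    have hsh := O.path_shortest _ _ _ P hP
    have hwα : ∀ e ∈ (delVerts G (O.avoid d c D α)).edgeSet, 0 < w e := fun e he =>
      hw e (SimpleGraph.edgeSet_mono (delVerts_le G _) he)
    obtain ⟨Q, hQP, hQ1, hQ2⟩ := exists_walk_of_mem_seg hwα he2 P hfP hfx hfy hzseg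
    obtain ⟨q, hq, hzq⟩ := exists_mem_VH_near (O := O) (c := c) (d := d) hn u v
      (delVerts_le G _) Q hzD hfD
      -- Failures on `Q` lie on `P_α`, so their level is at most `l(f)`; and `z ∈ U_{l(f)}` gives
      -- `l(f) ≤ l(z)`.
      fun t ht htD => (hfmax t ⟨htD, hQP t ht⟩).trans (le_level hzU)
    have hscale : ∀ L : ℝ, (len w Q : ℝ) ≤ eps2 V ε * L →
        (2 * kParam V - 1) * len w Q ≤ ε / (2 + ε) * L := by
      intro L hL
      calc (2 * kParam V - 1) * len w Q ≤ (2 * kParam V - 1) * (eps2 V ε * L) :=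
            mul_le_mul_of_nonneg_left hL (by linarith)
        _ = ε / (2 + ε) * L := by
            rw [eps2, ← mul_assoc, mul_div_cancel₀ _ (by linarith)]
    refine ⟨z, q, hq, hzP', hzseg.2.1, hzseg.2.2.1, fun A B hAB => ?_⟩
    subst hAB
    have hA : ∀ t ∈ A.support, t ∉ O.avoid d c D α := fun t ht => hP' t (by
      rw [SimpleGraph.Walk.mem_support_append_iff]; exact Or.inl ht)
    have hB : ∀ t ∈ B.support, t ∉ O.avoid d c D α := fun t ht => hP' t (by
      rw [SimpleGraph.Walk.mem_support_append_iff]; exact Or.inr ht)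
    obtain ⟨A', -, hA'⟩ := exists_walk_delVerts (w := w) (delVerts_le G D) A hA
    obtain ⟨B', -, hB'⟩ := exists_walk_delVerts (w := w) (delVerts_le G D) B hB
    -- The bounds for `Q` refer to `P_α`. Both parts of the given walk live in `G - avoid(α)`, where
    -- `P_α` is shortest, so they are no shorter than the corresponding parts of `P_α`.
    have h1 := lenTo_le_of_shortest hsh hzseg.1 A'
    have h2 := lenFrom_le_of_shortest hsh hzseg.1 B'
    rw [hA'] at h1
    rw [hB'] at h2
    constructor
    · refine hzq.trans (ENNReal.ofReal_le_ofReal (hscale _ (hQ1.trans ?_)))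
      gcongr
    · refine hzq.trans (ENNReal.ofReal_le_ofReal (hscale _ (hQ2.trans ?_)))
      gcongr
termination_by m

end DecisionTree

end Choices

/-! ### Distances in the auxiliary graph and the stretch bound -/

section AuxiliaryGraph
variable {V : Type*} {A : Set V} {wt : V → V → ℝ≥0∞}

lemma auxDist_self (a : A) : auxDist A wt a a = 0 :=
  le_antisymm ((iInf_le _ .nil).trans (by simp)) zero_le

lemma auxDist_le_add (a b c : A) : auxDist A wt a c ≤ wt a b + auxDist A wt b c := by
  -- The complete graph has no loop, so for `a = b` the step is omitted rather than walked.
  by_cases hab : a = b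
  · subst hab
    exact le_add_self
  · conv_rhs => rw [auxDist]
    rw [ENNReal.add_iInf]
    exact le_iInf fun P => (iInf_le _ (P.cons hab)).trans (by simp)

lemma auxDist_le (a b : A) : auxDist A wt a b ≤ wt a b := by
  simpa [auxDist_self] using auxDist_le_add (wt := wt) a b b

lemma gdist_le_auxDist {G : SimpleGraph V} {w : Sym2 V → ℝ≥0}
    (h : ∀ x ∈ A, ∀ y ∈ A, gdist G w x y ≤ wt x y) (a b : A) :
    gdist G w a b ≤ auxDist A wt a b := by
  refine le_iInf fun P => ?_
  induction P with
  | nil => simp [gdist_self]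
  | @cons a b c _ P ih =>
    rw [SimpleGraph.Walk.darts_cons, List.map_cons, List.sum_cons]
    exact (gdist_triangle _ _ _).trans (add_le_add (h a a.2 b b.2) ih)

/-- If every walk that `DecTree` fails to shortcut has a detour, then the step from `x` towards
`y` along a shortest path can be made by one almost exact edge. -/
lemma exists_hop [Finite V] {G : SimpleGraph V} {w : Sym2 V → ℝ≥0} (hw : ∀ e ∈ G.edgeSet, 0 < w e) {e : ℝ} (he : 0 < e)
    (he1 : e < 1) {x : V}
    (hwt : ∀ y ∈ A, ∀ P : G.Walk x y,
      wt x y ≤ len w P ∨ ∃ z, ∃ q ∈ A, IsDetour w e P z q)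
    {y : V} (hy : y ∈ A) (hxy : G.Reachable x y) :
    wt x y ≤ gdist G w x y ∨ ∃ q ∈ A, ∃ a b : ℝ≥0, 0 < a ∧ gdist G w x y = (a + b : ℝ≥0) ∧
      wt x q ≤ ENNReal.ofReal ((1 + e) * a) ∧ gdist G w q y ≤ ENNReal.ofReal (e * a + b) := by
  classical
  obtain ⟨P, hP⟩ := exists_shortest (w := w) hxy
  rcases hwt y hy P with h | ⟨z₀, q₀, hq₀, hz₀P, hz₀x, -, hdet₀⟩
  · exact Or.inl (hP.gdist_eq ▸ h)
  right
  have hz₀ : z₀ ∈ {z | z ∈ P.support ∧ z ≠ x ∧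
      ∃ q ∈ A, gdist G w z q ≤ ENNReal.ofReal (e * lenTo w P z)} := by
    refine ⟨hz₀P, hz₀x, q₀, hq₀, ?_⟩
    rw [lenTo_eq P hz₀P]
    exact (hdet₀ _ _ (P.take_spec hz₀P).symm).1
  -- Two extremal choices: `z` is closest to `x` among the vertices with a nearby member of `A`, and
  -- then `q` is the member of `A` nearest to `z`.
  obtain ⟨z, ⟨hzP, hzx, q₁, hq₁, hzq₁⟩, hzmin⟩ :=
    Set.exists_min_image _ (lenTo w P) (Set.toFinite _) ⟨z₀, hz₀⟩
  obtain ⟨q, hq, hqmin⟩ :=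
    Set.exists_min_image A (fun q => gdist G w z q) (Set.toFinite _) ⟨q₁, hq₁⟩
  have hzq := (hqmin q₁ hq₁).trans hzq₁
  obtain ⟨R, hR⟩ := exists_shortest (w := w)
    (gdist_lt_top.1 (hzq.trans_lt ENNReal.ofReal_lt_top))
  have hRd := hR.gdist_eq
  rw [lenTo_eq P hzP] at hzq
  set T := P.takeUntil z hzP with hT
  set B := P.dropUntil z hzP with hB
  have hTB : T.append B = P := P.take_spec hzP
  have hRle : (len w R : ℝ) ≤ e * len w T := by
    rw [hRd, ← ENNReal.ofReal_coe_nnreal] at hzq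
    exact (ENNReal.ofReal_le_ofReal_iff (by positivity)).1 hzq
  refine ⟨q, hq, len w T, len w B, len_pos hw _ hzx.symm, ?_, ?_, ?_⟩
  · rw [hP.gdist_eq, ← hTB, len_append]
  -- `T.append R` need not be a path. The detour estimate holds for every way to split the walk at
  -- `z'`, so the split can be placed within `R` or within `T`.
  · rcases hwt q hq (T.append R) with h | ⟨z', q', hq', hz', hz'x, hz'q, hdet⟩
    · refine h.trans ?_
      rw [← ENNReal.ofReal_coe_nnreal, len_append, NNReal.coe_add]
      exact ENNReal.ofReal_le_ofReal (by linarith)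
    exfalso
    by_cases hz'R : z' ∈ R.support
    · have hspec := R.take_spec hz'R
      set R₁ := R.takeUntil z' hz'R with hR₁
      set R₂ := R.dropUntil z' hz'R with hR₂
      have h1 := (hdet (T.append R₁) R₂ (by rw [← SimpleGraph.Walk.append_assoc, hspec])).2
      -- For `z'` on `R`, leaving towards `q'` costs at most `e |R₂| < |R₂|`, so `q'` would be
      -- nearer to `z` than `q`.
      have hpos : (0 : ℝ) < len w R₂ := len_pos hw _ hz'q
      have h2 : gdist G w z q' < gdist G w z q := by
        calc gdist G w z q' ≤ len w R₁ + ENNReal.ofReal (e * len w R₂) :=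
              (gdist_triangle z z' q').trans (add_le_add (gdist_le_len R₁) h1)
          _ = ENNReal.ofReal (len w R₁ + e * len w R₂) := by
              rw [ENNReal.ofReal_add (by positivity) (by positivity), ENNReal.ofReal_coe_nnreal]
          _ < ENNReal.ofReal (len w R₁ + len w R₂) := by
              rw [ENNReal.ofReal_lt_ofReal_iff (by positivity)]
              nlinarith
          _ = gdist G w z q := by
              rw [← NNReal.coe_add, ENNReal.ofReal_coe_nnreal, ← len_append, hspec, hRd]
      exact absurd (hqmin q' hq') (not_le.2 h2)
    · have hz'T : z' ∈ T.support :=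
        ((SimpleGraph.Walk.mem_support_append_iff _ _).1 hz').resolve_right hz'R
      have hz'z : z' ≠ z := fun h => hz'R (h ▸ R.start_mem_support)
      have hspec := T.take_spec hz'T
      have h1 := (hdet (T.takeUntil z' hz'T) ((T.dropUntil z' hz'T).append R)
        (by rw [SimpleGraph.Walk.append_assoc, hspec])).1
      have hz'P : z' ∈ P.support := P.support_takeUntil_subset_support hzP hz'T
      have h2 : T.takeUntil z' hz'T = P.takeUntil z' hz'P := P.takeUntil_takeUntil hzP hz'T
      rw [h2, ← lenTo_eq P hz'P] at h1
      -- For `z'` on `T` before `z`, the vertex `z'` would itself be a candidate closer to `x`.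
      have h3 := hzmin z' ⟨hz'P, hz'x, q', hq', h1⟩
      have h4 : len w T = len w (T.takeUntil z' hz'T) + len w (T.dropUntil z' hz'T) := by
        rw [← len_append, hspec]
      have h5 := len_pos hw (T.dropUntil z' hz'T) hz'z
      rw [lenTo_eq P hzP, lenTo_eq P hz'P, ← h2, NNReal.coe_le_coe, ← hT, h4] at h3
      exact absurd h3 (not_le.2 (lt_add_of_pos_right _ h5))
  · calc gdist G w q y ≤ len w R + len w B := by
          refine (gdist_triangle q z y).trans (add_le_add ?_ (gdist_le_len B))
          rw [gdist_comm, hRd]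
      _ = ENNReal.ofReal (len w R + len w B) := by
          rw [← NNReal.coe_add, ENNReal.ofReal_coe_nnreal, ENNReal.coe_add]
      _ ≤ _ := ENNReal.ofReal_le_ofReal (by linarith)

/-- If from every vertex of `A` one can make an almost exact step towards the target, the
stretch of the auxiliary distance is at most `1 + ε`, where `1 + ε = (1 + e) / (1 - e)`. -/
lemma auxDist_le_of_hop [Finite V] {G : SimpleGraph V} {w : Sym2 V → ℝ≥0} {e ε : ℝ}
    (he : 0 < e) (he1 : e < 1) (hε : 0 < ε) (heε : 1 + e = (1 + ε) * (1 - e)) (y : A)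
    (h : ∀ x : A, G.Reachable x y → wt x y ≤ gdist G w x y ∨
      ∃ q ∈ A, ∃ a b : ℝ≥0, 0 < a ∧ gdist G w x y = (a + b : ℝ≥0) ∧
        wt x q ≤ ENNReal.ofReal ((1 + e) * a) ∧ gdist G w q y ≤ ENNReal.ofReal (e * a + b))
    (x : A) : auxDist A wt x y ≤ ENNReal.ofReal (1 + ε) * gdist G w x y := by
  have wf : WellFounded (InvImage (· < ·) fun x : A => gdist G w x y) :=
    Finite.wellFounded_of_trans_of_irrefl _
  induction x using wf.induction with
  | _ x ih =>
    by_cases hxy : G.Reachable x y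
    · rcases h x hxy with h1 | ⟨q, hq, a, b, ha, hab, hxq, hqy⟩
      · refine (auxDist_le x y).trans (h1.trans (le_mul_of_one_le_left zero_le ?_))
        rw [← ENNReal.ofReal_one]
        exact ENNReal.ofReal_le_ofReal (by linarith)
      · have ha' : (0 : ℝ) < a := ha
        -- `e a + b < a + b` because `e < 1` and `a > 0`; this lets the induction on the distance to
        -- `y` proceed.
        have hlt : gdist G w q y < gdist G w x y := by
          refine hqy.trans_lt ?_
          rw [hab, ← ENNReal.ofReal_coe_nnreal, NNReal.coe_add,
            ENNReal.ofReal_lt_ofReal_iff (by positivity)]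
          nlinarith
        calc auxDist A wt x y ≤ wt x q + auxDist A wt ⟨q, hq⟩ y :=
              auxDist_le_add x ⟨q, hq⟩ y
          _ ≤ ENNReal.ofReal ((1 + e) * a) +
                ENNReal.ofReal (1 + ε) * ENNReal.ofReal (e * a + b) := by
              refine add_le_add hxq ((ih ⟨q, hq⟩ hlt).trans ?_)
              gcongr
          _ = ENNReal.ofReal ((1 + e) * a + (1 + ε) * (e * a + b)) := by
              rw [← ENNReal.ofReal_mul (by linarith),
                ENNReal.ofReal_add (by positivity) (by positivity)]
          -- The excess `e a` of the hop and of the remaining distance is absorbed exactly: `(1 + e)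
          -- + (1 + ε) e = 1 + ε`.
          _ = ENNReal.ofReal ((1 + ε) * (a + b)) := by
              congr 1
              rw [heε]
              ring
          _ = _ := by
              rw [hab, ENNReal.ofReal_mul (by linarith), ← NNReal.coe_add,
                ENNReal.ofReal_coe_nnreal]
    · rw [← gdist_lt_top (w := w), not_lt, top_le_iff] at hxy
      rw [hxy, ENNReal.mul_top (by simpa using by linarith)]
      exact le_top

end AuxiliaryGraph

end VSDO

/-! ### Conclusion -/

theorem mainTheorem3 {V : Type*} [Fintype V] [DecidableEq V]
    (hn : 3 ≤ Fintype.card V)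
    (G : SimpleGraph V) (w : Sym2 V → ℝ≥0) (hw : ∀ e ∈ G.edgeSet, 0 < w e)
    (d : ℕ) (hd : 2 ≤ d) (c : ℝ) (hc : 1 ≤ c) (ε : ℝ) (hε : 0 < ε)
    (O : VSDO.Choices G w)
    (D : Set V) (hD : D.ncard ≤ d)
    (pick : V → V → VSDO.Node V → V) (hpick : O.IsPick d c D pick)
    (u₀ v₀ : V) (hu₀ : u₀ ∉ D) (hv₀ : v₀ ∉ D) :
    ∃ wt : V → V → ℝ≥0∞,
      (∀ x ∈ O.VH d c D u₀ v₀, ∀ y ∈ O.VH d c D u₀ v₀,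
        O.decTree d c ε D pick x y = some (wt x y)) ∧
      ∀ u v : O.VH d c D u₀ v₀,
        VSDO.gdist (VSDO.delVerts G D) w u v ≤ VSDO.auxDist (O.VH d c D u₀ v₀) wt u v ∧
        VSDO.auxDist (O.VH d c D u₀ v₀) wt u v ≤
          ENNReal.ofReal (1 + ε) * VSDO.gdist (VSDO.delVerts G D) w u v := by
  -- Costs are chosen for all pairs, with a dummy value when an end point has failed; members of
  -- `VH` never have.
  have hex : ∀ x y, ∃ r, x ∉ D → y ∉ D → O.decTree d c ε D pick x y = some r ∧
      VSDO.gdist (VSDO.delVerts G D) w x y ≤ r ∧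
      ∀ P : (VSDO.delVerts G D).Walk x y, r ≤ VSDO.len w P ∨
        ∃ z, ∃ q ∈ O.VH d c D u₀ v₀, VSDO.IsDetour w (ε / (2 + ε)) P z q := by
    intro x y
    by_cases h : x ∉ D ∧ y ∉ D
    · obtain ⟨r, h1, h2, h3⟩ := VSDO.Choices.decTreeLoop_spec hn hw hε hpick u₀ v₀ h.1 h.2 d []
        (by simpa [VSDO.Choices.avoid] using hD) (Set.notMem_empty x) (Set.notMem_empty y)
      exact ⟨r, fun _ _ => ⟨h1, h2, fun P => h3 P fun t _ => Set.notMem_empty t⟩⟩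
    · exact ⟨0, fun hx hy => absurd ⟨hx, hy⟩ h⟩
  choose wt hwt using hex
  have hwD : ∀ e ∈ (VSDO.delVerts G D).edgeSet, 0 < w e := fun e he =>
    hw e (SimpleGraph.edgeSet_mono (VSDO.delVerts_le G D) he)
  have he : 0 < ε / (2 + ε) := by positivity
  have he1 : ε / (2 + ε) < 1 := by rw [div_lt_one (by linarith)]; linarith
  refine ⟨wt, fun x hx y hy => (hwt x y hx.2 hy.2).1, fun u v => ⟨?_, ?_⟩⟩
  · exact VSDO.gdist_le_auxDist (fun x hx y hy => (hwt x y hx.2 hy.2).2.1) u v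
  -- With `e = ε / (2 + ε)`, `1 + e = 2 (1 + ε) / (2 + ε)` and `1 - e = 2 / (2 + ε)`.
  · refine VSDO.auxDist_le_of_hop he he1 hε (by field_simp; ring) v (fun x hxv => ?_) u
    exact VSDO.exists_hop hwD he he1
      (fun y hy P => (hwt x y x.2.2 hy.2).2.2 P) v.2 hxv
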